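/- **Definitions.** Let $p : X \to B$ be a continuous map into a metric space $(B,d)$. For $\delta>0$, $p$ is a $UV^1(\delta)$ map if for every 2-complex $K$ (a CW complex without cells of dimension $>2$), every subcomplex $K_0\subset K$ and all continuous maps $\alpha_0:K_0\to X$ and $\alpha:K\to B$ with $p\circ\alpha_0=\alpha|_{K_0}$, there is a continuous map $\bar\alpha:K\to X$ with $\bar\alpha|_{K_0}=\alpha_0$ and $d(p(\bar\alpha(u)),\alpha(u))<\delta$ for all $u\in K$. A continuous map $p$ into a metrizable space $B$ is a $UV^1$ map if it is $UV^1(\delta)$ for every $\delta>0$ with respect to every metric inducing the topology of $B$. Let $n\ge 3$, let $M$ and $M'$ be topological $n$-manifolds (Hausdorff, second countable, without boundary), and let $e:\mathbb R^n\to M$ and $e':\mathbb R^n\to M'$ be open topological embeddings. With $\mathring D^n$ the open unit ball, $S^{n-1}$ the unit sphere and $\|\cdot\|$ the Euclidean norm, put $M_0=M\setminus e(\mathring D^n)$, $M_0'=M'\setminus e'(\mathring D^n)$, and let $$M\# M' = (M_0\sqcup M_0')/\big(e(v)\sim e'(v),\ v\in S^{n-1}\big)$$ be the connected sum. Let $s:M_0\to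 M$ be the map which stretches the collar $e(\{1\le\|v\|\le2\})$ radially over the ball $e(\{\|v\|\le 2\})$, that is, $s(e(v))=e\big((2\|v\|-2)\,v/\|v\|\big)$ for $1\le\|v\|\le 2$, and which is the identity elsewhere; let $s':M'_0\to M'$ be the analogous map for $e'$. Let $M\vee M'=M\times\{e'(0)\}\cup\{e(0)\}\times M'\subset M\times M'$ be the wedge at the base points $e(0)$ and $e'(0)$. Define * the collapsing map $p:M\# M'\to M$ by $p=s$ on $M_0$ and $p=e(0)$ on $M_0'$; * the smash map $q:M\# M'\to M\vee M'$ by $q(x)=(s(x),e'(0))$ for $x\in M_0$ and $q(y)=(e(0),s'(y))$ for $y\in M_0'$. **Lemma.** (1) If $M'$ is simply connected, then $p: M\# M'\to M$, which collapses $M'$ to a point, is a $UV^1$ map. (2) The smash map $q:M\# M'\to M\vee M'$ is a $UV^1$ map (whether or not $M'$ is simply connected). -/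

import Mathlib

open Set Metric Topology

universe w u v

noncomputable section

/-- The space `K` with the given CW structure is a 2-complex: it has no cells of dimension `> 2`. -/
def IsTwoComplex (K : Type*) [TopologicalSpace K] [CWComplex (univ : Set K)] : Prop :=
  ∀ m : ℕ, 2 < m → IsEmpty (RelCWComplex.cell (univ : Set K) m)

/-- The `UV¹(δ)` property of `p : X → B` with respect to a distance function `d` on `B`:
for every 2-complex `K`, every subcomplex `K₀ ⊆ K` and all maps `α₀ : K₀ → X`, `α : K → B` with
`p ∘ α₀ = α|K₀`, there is a map `α' : K → X` which extends `α₀` and satisfies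
`d (p (α' u)) (α u) < δ` for all `u ∈ K`. -/
def IsUV1DeltaMap.{a, b, c} {X : Type b} {B : Type c} [TopologicalSpace X] [TopologicalSpace B]
    (d : B → B → ℝ) (p : X → B) (δ : ℝ) : Prop :=
  ∀ (K : Type a) [TopologicalSpace K] [T2Space K] [CWComplex (univ : Set K)],
    IsTwoComplex K →
    ∀ (K₀ : RelCWComplex.Subcomplex (univ : Set K)) (α₀ : C(K₀, X)) (α : C(K, B)),
      (∀ u : K₀, p (α₀ u) = α u) →
      ∃ α' : C(K, X), (∀ u : K₀, α' u = α₀ u) ∧ ∀ u : K, d (p (α' u)) (α u) < δ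

/-- A `UV¹` map into a metrizable space: a continuous map which is `UV¹(δ)` for every `δ > 0`,
with respect to each metric inducing the topology of the target (for a compact target the choice
of the metric is immaterial). The first universe is that of the test complexes. -/
def IsUV1Map.{a, b, c} {X : Type b} {B : Type c} [TopologicalSpace X] [tB : TopologicalSpace B]
    (p : X → B) : Prop :=
  Continuous p ∧ TopologicalSpace.MetrizableSpace B ∧
    ∀ m : MetricSpace B, m.toUniformSpace.toTopologicalSpace = tB →
      ∀ δ : ℝ, 0 < δ → IsUV1DeltaMap.{a} m.dist p δ

/-- A coordinate neighbourhood `ℝⁿ ≅ U ⊆ M`, `U` open. The image of the unit ball is the ball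
removed from `M` in a connected sum; the image of the shell `1 ≤ ‖v‖ ≤ 2` is a collar of the
boundary of the rest. -/
structure CoordBall (n : ℕ) (M : Type*) [TopologicalSpace M] where
  /-- The embedding of `ℝⁿ`. -/
  emb : EuclideanSpace ℝ (Fin n) → M
  isOpenEmbedding : IsOpenEmbedding emb

namespace CoordBall

variable {n : ℕ} {M : Type*} [TopologicalSpace M]

/-- The centre of the ball. -/
def center (e : CoordBall n M) : M := e.emb 0

/-- `M` with the open unit ball removed. -/
def complBall (e : CoordBall n M) : Set M := (e.emb '' ball 0 1)ᶜ

/-- The radial self-map of `ℝⁿ` sending the sphere of radius `r` to the sphere of radius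
`max 0 (min r (2 * r - 2))`: the unit ball goes to the origin, the shell `1 ≤ r ≤ 2` is stretched
onto the ball of radius `2`, and the points with `r ≥ 2` are fixed. -/
def radial (v : EuclideanSpace ℝ (Fin n)) : EuclideanSpace ℝ (Fin n) :=
  (max 0 (min ‖v‖ (2 * ‖v‖ - 2)) / ‖v‖) • v

/-- The map `M → M` which is `radial` in the coordinate neighbourhood and the identity outside. -/
def shrink (e : CoordBall n M) : M → M :=
  Function.extend e.emb (fun v => e.emb (radial v)) id

theorem shrink_emb_of_norm_eq_one (e : CoordBall n M) {v : EuclideanSpace ℝ (Fin n)}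
    (hv : ‖v‖ = 1) : e.shrink (e.emb v) = e.center := by
  rw [shrink, e.isOpenEmbedding.injective.extend_apply]
  simp [radial, hv, center]

end CoordBall

section

variable {n : ℕ} {M M' : Type*} [TopologicalSpace M] [TopologicalSpace M']

/-- The identification of the two boundary spheres. -/
inductive ConnectedSum.Rel (e : CoordBall n M) (e' : CoordBall n M') :
    e.complBall ⊕ e'.complBall → e.complBall ⊕ e'.complBall → Prop
  | glue (v : EuclideanSpace ℝ (Fin n)) (hv : ‖v‖ = 1)
      (h : e.emb v ∈ e.complBall) (h' : e'.emb v ∈ e'.complBall) :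
      ConnectedSum.Rel e e' (Sum.inl ⟨e.emb v, h⟩) (Sum.inr ⟨e'.emb v, h'⟩)

/-- The connected sum `M # M'` formed with the balls `e` and `e'`: the open unit balls are removed
and the boundary spheres of the remaining parts are identified. (Other identifications of the
spheres, such as orientation-reversing ones, result from other choices of `e'`.) -/
def ConnectedSum (e : CoordBall n M) (e' : CoordBall n M') : Type _ :=
  Quot (ConnectedSum.Rel e e')

instance (e : CoordBall n M) (e' : CoordBall n M') : TopologicalSpace (ConnectedSum e e') :=
  inferInstanceAs (TopologicalSpace (Quot (ConnectedSum.Rel e e')))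

/-- The wedge `M ∨ M'` of `(M, b)` and `(M', b')`, as the subspace
`M × {b'} ∪ {b} × M'` of `M × M'`. -/
abbrev Wedge (b : M) (b' : M') : Type _ := {q : M × M' // q.1 = b ∨ q.2 = b'}

/-- The collapsing map `M # M' → M`. It sends the whole part coming from `M'` to one point, the
centre of the ball in `M`, and stretches the collar in `M` over that ball. -/
def ConnectedSum.collapse (e : CoordBall n M) (e' : CoordBall n M') : ConnectedSum e e' → M :=
  Quot.lift (Sum.elim (fun x => e.shrink x) (fun _ => e.center)) <| by
    rintro _ _ ⟨v, hv, h, h'⟩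
    exact e.shrink_emb_of_norm_eq_one hv

/-- The smash map `M # M' → M ∨ M'`. It sends the gluing sphere to the base point of the wedge and
stretches the two collars of the sphere over the two balls. -/
def ConnectedSum.smash (e : CoordBall n M) (e' : CoordBall n M') :
    ConnectedSum e e' → Wedge e.center e'.center :=
  Quot.lift (Sum.elim (fun x => ⟨(e.shrink x, e'.center), Or.inr rfl⟩)
    (fun y => ⟨(e.center, e'.shrink y), Or.inl rfl⟩)) <| by
    rintro _ _ ⟨v, hv, h, h'⟩
    simp [e.shrink_emb_of_norm_eq_one hv, e'.shrink_emb_of_norm_eq_one hv]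

end

end

noncomputable section

/-! The collapse is the smash map followed by the projection of the wedge to `M`, so it is enough to
lift approximately through these two maps in turn. Closeness is expressed without a metric: at each
point the lift is exact, or its image and its target both lie in a small ball about the base point.
For any compatible metric a small enough ball has diameter below `δ`. Lifts are built over the cells
of dimension 0, 1, 2, each dimension costing a slight enlargement of the ball
(`exists_extension_of_cellExtension`). What remains is to extend a lift from the boundary of a cube.

For the smash map (`cellExtension_smash`): it is closed, and injective off the fibre of the base
point, so away from that point the lift is forced and continuous. Over a ball about the base point
lies the neck, an annulus in `ℝⁿ`. Since the cube has dimension less than `n`, a map from a closed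
subset into the annulus extends: Tietze, then a push off the origin (`exists_extension_annulus`).
Nothing about the topology of `M'` enters.

For the projection (`cellExtension_fst`): it has the section `wedgeInl`, and the part of the wedge
over a coordinate ball retracts by deformation onto `M'`, hence is simply connected if `M'` is. On
the boundary of the cube, the given lift and the section differ only over the ball. As this boundary
is at most a circle, simple connectivity gives a homotopy between them which runs over a slightly
larger ball there and is constant elsewhere (`exists_track_sphere`). It is inserted into a collar
whose width tapers to zero away from the ball. -/

/-- Lifting of maps on the cube `[-1, 1]ᵐ` through a space `T` over `B`, where closeness of a lift
is measured by relations: each lift over the boundary which is `R`-close extends to a lift over the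
cube which is `R'`-close. -/
def CellExtension {T B : Type*} [TopologicalSpace T] [TopologicalSpace B] (m : ℕ)
    (R R' : T → B → Prop) : Prop :=
  ∀ α : (Fin m → ℝ) → B, Continuous α → ∀ β₀ : (Fin m → ℝ) → T,
    ContinuousOn β₀ (sphere 0 1) → (∀ x ∈ sphere (0 : Fin m → ℝ) 1, R (β₀ x) (α x)) →
    ∃ β : (Fin m → ℝ) → T, ContinuousOn β (closedBall 0 1) ∧ EqOn β β₀ (sphere 0 1) ∧
      ∀ x ∈ closedBall (0 : Fin m → ℝ) 1, R' (β x) (α x)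

/-! ### Radial retraction onto the unit ball -/

section Clamp

variable {E : Type*} [NormedAddCommGroup E] [NormedSpace ℝ E]

/-- The radial retraction onto the closed unit ball. -/
def clampBall (z : E) : E := (max 1 ‖z‖)⁻¹ • z

theorem continuous_clampBall : Continuous (clampBall : E → E) := by
  unfold clampBall
  refine Continuous.smul (Continuous.inv₀ (by fun_prop) fun z => ?_) continuous_id
  exact (lt_of_lt_of_le one_pos (le_max_left _ _)).ne'

theorem clampBall_of_norm_le {z : E} (hz : ‖z‖ ≤ 1) : clampBall z = z := by
  simp [clampBall, max_eq_left hz]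

theorem norm_clampBall (z : E) : ‖clampBall z‖ = min 1 ‖z‖ := by
  have h : (0 : ℝ) < max 1 ‖z‖ := lt_of_lt_of_le one_pos (le_max_left _ _)
  rw [clampBall, norm_smul, norm_inv, Real.norm_of_nonneg h.le]
  rcases le_total ‖z‖ 1 with h1 | h1
  · simp [h1]
  · rw [max_eq_right h1, min_eq_left h1, inv_mul_cancel₀ (by linarith)]

theorem clampBall_mem (z : E) : clampBall z ∈ closedBall (0 : E) 1 := by
  simp [norm_clampBall]

end Clamp

/-- A continuous map from a compact set to a Hausdorff space is closed, hence a quotient map onto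
its image. -/
theorem ContinuousOn.of_comp_isCompact {A B C : Type*} [TopologicalSpace A] [TopologicalSpace B]
    [T2Space B] [TopologicalSpace C] {φ : A → B} {f : B → C} {s : Set A} (hs : IsCompact s)
    (hφ : ContinuousOn φ s) (hf : ContinuousOn (f ∘ φ) s) : ContinuousOn f (φ '' s) := by
  rw [continuousOn_iff_isClosed]
  intro t ht
  obtain ⟨u, hu, hus⟩ := (continuousOn_iff_isClosed.1 hf) t ht
  refine ⟨φ '' (u ∩ s), ((hs.inter_left hu).image_of_continuousOn
    (hφ.mono inter_subset_right)).isClosed, ?_⟩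
  rw [← hus]
  ext y
  constructor
  · rintro ⟨hy, x, hx, rfl⟩
    exact ⟨⟨x, ⟨hy, hx⟩, rfl⟩, x, hx, rfl⟩
  · rintro ⟨⟨x, ⟨hy, hx⟩, rfl⟩, -⟩
    exact ⟨hy, x, hx, rfl⟩

/-! ### Extension of lifts over a 2-complex -/

section CW

open RelCWComplex

variable {K : Type w} [TopologicalSpace K] [T2Space K] [CWComplex (univ : Set K)]
  {T : Type*} {B : Type*} [TopologicalSpace T] [TopologicalSpace B]

theorem disjoint_openCell_closedCell_of_lt {m k : ℕ} (h : m < k) (i : cell (univ : Set K) k)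
    (j : cell (univ : Set K) m) : Disjoint (openCell k i) (closedCell m j) := by
  have h1 : (closedCell m j : Set K) ⊆ skeletonLT (univ : Set K) (m + 1 : ℕ) := by
    exact_mod_cast closedCell_subset_skeletonLT m j
  refine Disjoint.mono_right h1 (Disjoint.symm (disjoint_skeletonLT_openCell ?_))
  exact_mod_cast h

/-- Extension of a partial lift over the cells of one dimension. -/
theorem exists_extension_step [Nonempty T] {R R' : T → B → Prop} (hR : ∀ w b, R w b → R' w b)
    {k : ℕ} (hext : CellExtension k R R') (K₀ : RelCWComplex.Subcomplex (univ : Set K))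
    (α : C(K, B)) (f : K → T) (hf₀ : ContinuousOn f K₀) (hRf₀ : ∀ x ∈ K₀, R (f x) (α x))
    (hf : ∀ m < k, ∀ i : cell (univ : Set K) m, ContinuousOn f (closedCell m i) ∧
      ∀ x ∈ closedCell m i, R (f x) (α x)) :
    ∃ f' : K → T, EqOn f' f K₀ ∧ ∀ m < k + 1, ∀ i : cell (univ : Set K) m,
      ContinuousOn f' (closedCell m i) ∧ ∀ x ∈ closedCell m i, R' (f' x) (α x) := by
  classical
  have hβ : ∀ i : cell (univ : Set K) k, ∃ β : (Fin k → ℝ) → T,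
      ContinuousOn β (closedBall 0 1) ∧ EqOn β (f ∘ map k i) (sphere 0 1) ∧
      ∀ x ∈ closedBall (0 : Fin k → ℝ) 1, R' (β x) (α (map k i x)) := by
    intro i
    obtain ⟨I, hI⟩ := CWComplex.cellFrontier_subset_finite_closedCell (C := univ) k i
    set S : Set K := ⋃ (m < k) (j ∈ I m), closedCell m j with hS
    have hmaps : MapsTo (map k i) (sphere 0 1) S := fun x hx => hI ⟨x, hx, rfl⟩
    -- The frontier lies in finitely many closed cells of lower dimension, so continuity on each of
    -- them suffices.
    have hfS : ContinuousOn f S := by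
      have : S = ⋃ p : (Σ m : Fin k, I m), closedCell (p.1 : ℕ) (p.2 : cell (univ : Set K) p.1) := by
        ext x
        simp only [hS, mem_iUnion, Sigma.exists, Subtype.exists, Fin.exists_iff, exists_prop]
        exact ⟨fun ⟨m, hm, h⟩ => ⟨m, hm, h⟩, fun ⟨m, hm, h⟩ => ⟨m, hm, h⟩⟩
      rw [this]
      exact (locallyFinite_of_finite _).continuousOn_iUnion (fun _ => isClosed_closedCell)
        (fun p => (hf p.1 p.1.2 p.2).1)
    -- `CellExtension` wants a map continuous on all of `Fin k → ℝ`; `clampBall` extends the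
    -- characteristic map beyond the cube.
    obtain ⟨β, h1, h2, h3⟩ := hext (fun x => α (map k i (clampBall x)))
      (α.continuous.comp ((continuousOn k i).comp_continuous continuous_clampBall clampBall_mem))
      (f ∘ map k i) (hfS.comp ((continuousOn k i).mono sphere_subset_closedBall) hmaps) (by
        intro x hx
        rw [clampBall_of_norm_le (by simpa using (mem_sphere_zero_iff_norm.1 hx).le)]
        obtain ⟨m, hm, j, -, hxj⟩ : ∃ m, ∃ _ : m < k, ∃ j, ∃ _ : j ∈ I m, map k i x ∈ closedCell m j := by
          simpa only [hS, mem_iUnion] using hmaps hx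
        exact (hf m hm j).2 _ hxj)
    refine ⟨β, h1, h2, fun x hx => ?_⟩
    have := h3 x hx
    rwa [clampBall_of_norm_le (by simpa using hx)] at this
  choose β hβc hβs hβR using hβ
  let P : K → cell (univ : Set K) k → Prop := fun x i => i ∉ K₀.I k ∧ x ∈ openCell k i
  -- Only open `k`-cells outside `K₀` get new values. They are disjoint from each other, from `K₀`
  -- and from the lower cells, so the choice is forced and nothing older changes.
  let f' : K → T := fun x => if h : ∃ i, P x i then β h.choose ((map k h.choose).symm x) else f x
  have hf'1 : ∀ i ∉ K₀.I k, ∀ x ∈ ball (0 : Fin k → ℝ) 1, f' (map k i x) = β i x := by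
    intro i hi x hx
    have h : ∃ j, P (map k i x) j := ⟨i, hi, x, hx, rfl⟩
    have hj : h.choose = i := by
      by_contra hne
      have := disjoint_openCell_of_ne (C := (univ : Set K)) (n := k) (m := k) (i := h.choose) (j := i)
        (by simpa using hne)
      exact this.le_bot ⟨h.choose_spec.2, x, hx, rfl⟩
    simp only [f', dif_pos h]
    rw [hj, (map k i).left_inv (by rwa [source_eq])]
  have hf'2 : ∀ x, (¬ ∃ i, P x i) → f' x = f x := fun x h => by simp only [f', dif_neg h]
  have hf'3 : EqOn f' f K₀ := by
    intro x hx
    refine hf'2 x ?_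
    rintro ⟨i, hi, hxi⟩
    exact (Subcomplex.disjoint_openCell_subcomplex_of_not_mem K₀ hi).le_bot ⟨hxi, hx⟩
  have hf'4 : ∀ m < k, ∀ j : cell (univ : Set K) m, EqOn f' f (closedCell m j) := by
    intro m hm j x hx
    refine hf'2 x ?_
    rintro ⟨i, hi, hxi⟩
    exact (disjoint_openCell_closedCell_of_lt hm i j).le_bot ⟨hxi, hx⟩
  refine ⟨f', hf'3, fun m hm i => ?_⟩
  rcases Nat.lt_succ_iff_lt_or_eq.1 hm with hm | rfl
  · refine ⟨(hf m hm i).1.congr (hf'4 m hm i), fun x hx => ?_⟩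
    rw [hf'4 m hm i hx]
    exact hR _ _ ((hf m hm i).2 x hx)
  by_cases hi : i ∈ K₀.I m
  · have hsub : closedCell m i ⊆ (K₀ : Set K) := Subcomplex.closedCell_subset_of_mem K₀ hi
    refine ⟨(hf₀.mono hsub).congr (hf'3.mono hsub), fun x hx => ?_⟩
    rw [hf'3 (hsub hx)]
    exact hR _ _ (hRf₀ x (hsub hx))
  · have heq : EqOn (f' ∘ map m i) (β i) (closedBall 0 1) := by
      intro x hx
      rw [← sphere_union_ball] at hx
      rcases hx with hx | hx
      · obtain ⟨I, hI⟩ := CWComplex.cellFrontier_subset_finite_closedCell (C := univ) m i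
        obtain ⟨l, hl, j, -, hxj⟩ : ∃ l, ∃ _ : l < m, ∃ j, ∃ _ : j ∈ I l, map m i x ∈ closedCell l j := by
          simpa only [mem_iUnion] using hI ⟨x, hx, rfl⟩
        rw [Function.comp, hf'4 l hl j hxj, hβs i hx]; rfl
      · exact hf'1 i hi x hx
    refine ⟨ContinuousOn.of_comp_isCompact (isCompact_closedBall 0 1) (continuousOn m i)
      ((hβc i).congr heq), ?_⟩
    rintro _ ⟨x, hx, rfl⟩
    have := hβR i x hx
    rwa [← heq hx] at this

/-- Three steps, in dimensions 0, 1, 2, carry the relation from `R 0` to `R 3`. The resulting map is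
continuous because a set is closed when its traces on all closed cells are. -/
theorem exists_extension_of_cellExtension (hK : IsTwoComplex K) [Nonempty T]
    {R : ℕ → T → B → Prop} (hmono : ∀ m w b, R m w b → R (m + 1) w b)
    (hext : ∀ m ≤ 2, CellExtension m (R m) (R (m + 1)))
    (K₀ : RelCWComplex.Subcomplex (univ : Set K)) (α₀ : C(K₀, T)) (α : C(K, B))
    (h : ∀ u : K₀, R 0 (α₀ u) (α u)) :
    ∃ α' : C(K, T), (∀ u : K₀, α' u = α₀ u) ∧ ∀ u : K, R 3 (α' u) (α u) := by
  classical
  have key : ∀ k ≤ 3, ∃ f : K → T, (∀ u : K₀, f u = α₀ u) ∧ ∀ m < k, ∀ i : cell (univ : Set K) m,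
      ContinuousOn f (closedCell m i) ∧ ∀ x ∈ closedCell m i, R k (f x) (α x) := by
    intro k
    induction k with
    | zero =>
      intro _
      -- The value off `K₀` is immaterial: each later step overwrites it on the open cells of its
      -- dimension.
      refine ⟨fun x => if hx : x ∈ K₀ then α₀ ⟨x, hx⟩ else Classical.arbitrary T,
        fun u => by simp, fun m hm => absurd hm (Nat.not_lt_zero m)⟩
    | succ k ih =>
      intro hk
      obtain ⟨f, hf0, hf⟩ := ih (by omega)
      have hR0 : ∀ k, ∀ w b, R 0 w b → R k w b := by
        intro k
        induction k with
        | zero => exact fun _ _ h => h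
        | succ k ih => exact fun w b h => hmono _ _ _ (ih w b h)
      obtain ⟨f', h1, h2⟩ := exists_extension_step (hmono k) (hext k (by omega)) K₀ α f
        (continuousOn_iff_continuous_domRestrict.2 (by
          convert! α₀.continuous using 1
          exact funext hf0))
        (fun x hx => by
          rw [hf0 ⟨x, hx⟩]
          exact hR0 k _ _ (h ⟨x, hx⟩)) hf
      exact ⟨f', fun u => (h1 u.2).trans (hf0 u), h2⟩
  obtain ⟨f, hf0, hf⟩ := key 3 le_rfl
  have hdim : ∀ m, ∀ _ : cell (univ : Set K) m, m < 3 := by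
    intro m i
    by_contra hm
    exact (hK m (by omega)).false i
  refine ⟨⟨f, ?_⟩, hf0, fun u => ?_⟩
  · rw [continuous_iff_isClosed]
    intro Z hZ
    rw [CWComplex.closed (univ : Set K) _ (subset_univ _)]
    intro m j
    rw [inter_comm]
    exact (hf m (hdim m j) j).1.preimage_isClosed_of_isClosed isClosed_closedCell hZ
  · have hu : u ∈ ⋃ (n : ℕ) (j : cell (univ : Set K) n), closedCell n j := by
      rw [CWComplex.union]; trivial
    simp only [mem_iUnion] at hu
    obtain ⟨m, j, hj⟩ := hu
    exact (hf m (hdim m j) j).2 u hj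

end CW

/-! ### General position: maps into an annulus -/

/-- A continuous map of a cube into a normed space of larger dimension can be changed where its norm
is less than `a` so that it avoids the origin. -/
theorem exists_continuous_ne_zero {E F : Type*} [NormedAddCommGroup E] [NormedSpace ℝ E]
    [FiniteDimensional ℝ E] [NormedAddCommGroup F] [NormedSpace ℝ F] [FiniteDimensional ℝ F]
    (hEF : Module.finrank ℝ E < Module.finrank ℝ F) {a : ℝ} (ha : 0 < a) {f : E → F}
    (hf : Continuous f) : ∃ k : E → F, Continuous k ∧ (∀ x, k x ≠ 0) ∧ ∀ x, a ≤ ‖f x‖ → k x = f x := by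
  obtain ⟨g, hg, hgf, -⟩ := hf.exists_contDiff_approx 1 (ε := fun _ => a / 4) continuous_const
    (fun _ => by positivity)
  -- The range of a `C¹` map into a larger dimension has dense complement, so a small `w` is missed
  -- and `g - w` never vanishes.
  obtain ⟨w, hwg, hw⟩ := (hg.dense_compl_range_of_finrank_lt_finrank hEF).exists_mem_open
    (isOpen_ball (x := (0 : F)) (ε := a / 4)) ⟨0, by simp [ha]⟩
  have hw' : ‖w‖ < a / 4 := by simpa using hw
  -- `τ` is 0 up to `a / 2` and 1 from `a` on, so the blend below is `g - w` where `f` is small and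
  -- `f` where `f` is large. Between them a zero would force `‖f x‖` below `a / 2`.
  let τ : ℝ → ℝ := fun s => min 1 (max 0 (2 * s / a - 1))
  have hτ : Continuous τ := by fun_prop
  have hclose : ∀ x, ‖f x - (g x - w)‖ < a / 2 := by
    intro x
    have h1 : ‖f x - g x‖ < a / 4 := by
      have := hgf x
      rwa [dist_comm, dist_eq_norm] at this
    calc ‖f x - (g x - w)‖ = ‖(f x - g x) + w‖ := by congr 1; abel
      _ ≤ ‖f x - g x‖ + ‖w‖ := norm_add_le _ _
      _ < a / 2 := by linarith
  refine ⟨fun x => (g x - w) + τ ‖f x‖ • (f x - (g x - w)), ?_, fun x => ?_, fun x hx => ?_⟩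
  · have := hg.continuous
    fun_prop
  · rcases le_or_gt ‖f x‖ (a / 2) with h | h
    · have : τ ‖f x‖ = 0 := by
        have : 2 * ‖f x‖ / a - 1 ≤ 0 := by
          rw [sub_nonpos, div_le_one ha]; linarith
        simp [τ, max_eq_left this]
      simp only [this, zero_smul, add_zero]
      exact fun h0 => hwg ⟨x, sub_eq_zero.1 h0⟩
    · intro h0
      beta_reduce at h0
      have hτ0 : 0 ≤ τ ‖f x‖ := le_min zero_le_one (le_max_left _ _)
      have hτ1 : τ ‖f x‖ ≤ 1 := min_le_left _ _
      have h2 : f x = (1 - τ ‖f x‖) • (f x - (g x - w)) := by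
        rw [sub_smul, one_smul]
        have : f x - (g x - w) - τ ‖f x‖ • (f x - (g x - w)) =
          f x - ((g x - w) + τ ‖f x‖ • (f x - (g x - w))) := by abel
        rw [this, h0, sub_zero]
      have h3 : ‖f x‖ ≤ ‖f x - (g x - w)‖ := by
        conv_lhs => rw [h2]
        rw [norm_smul, Real.norm_of_nonneg (by linarith)]
        exact mul_le_of_le_one_left (norm_nonneg _) (by linarith)
      linarith [hclose x]
  · have : τ ‖f x‖ = 1 := by
      have h1 : 1 ≤ 2 * ‖f x‖ / a - 1 := by
        rw [le_sub_iff_add_le, le_div_iff₀ ha]; linarith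
      simp [τ, h1]
    simp only [this, one_smul]
    abel

/-- Maps from closed subsets of a Euclidean space into an annulus of larger dimension extend. -/
theorem exists_extension_annulus {E F : Type*} [NormedAddCommGroup E] [NormedSpace ℝ E]
    [FiniteDimensional ℝ E] [NormedAddCommGroup F] [NormedSpace ℝ F] [FiniteDimensional ℝ F]
    (hEF : Module.finrank ℝ E < Module.finrank ℝ F) {a b : ℝ} (ha : 0 < a) (hab : a ≤ b)
    {S : Set E} (hS : IsClosed S) {f : E → F} (hf : ContinuousOn f S)
    (hfS : ∀ x ∈ S, ‖f x‖ ∈ Icc a b) :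
    ∃ g : E → F, Continuous g ∧ EqOn g f S ∧ ∀ x, ‖g x‖ ∈ Icc a b := by
  have : TietzeExtension F := TietzeExtension.of_tvs ℝ
  obtain ⟨f', hf'⟩ := ContinuousMap.exists_restrict_eq hS
    ⟨S.domRestrict f, continuousOn_iff_continuous_domRestrict.1 hf⟩
  have hf'S : EqOn f' f S := fun x hx => DFunLike.congr_fun hf' ⟨x, hx⟩
  obtain ⟨k, hk, hk0, hkf⟩ := exists_continuous_ne_zero hEF ha f'.continuous
  have hk0' : ∀ x, ‖k x‖ ≠ 0 := fun x => norm_ne_zero_iff.2 (hk0 x)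
  -- Clamp the norm to `[a, b]`, keeping the direction.
  refine ⟨fun x => (max a (min b ‖k x‖) / ‖k x‖) • k x, ?_, fun x hx => ?_, fun x => ?_⟩
  · exact (((continuous_const.max (continuous_const.min hk.norm)).div hk.norm hk0').smul hk)
  · have h := hfS x hx
    have h2 : k x = f x := by rw [hkf x (by rw [hf'S hx]; exact h.1), hf'S hx]
    have h3 : ‖f x‖ ≠ 0 := by rw [← h2]; exact hk0' x
    simp only [h2, min_eq_right h.2, max_eq_right h.1, div_self h3, one_smul]
  · rw [norm_smul, norm_div, norm_norm, div_mul_cancel₀ _ (hk0' x), Real.norm_of_nonneg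
      (ha.le.trans (le_max_left _ _))]
    exact ⟨le_max_left _ _, max_le hab (min_le_left _ _)⟩

/-! ### Stretching the collar of a coordinate ball -/

namespace CoordBall

variable {n : ℕ} {M : Type*} [TopologicalSpace M]

theorem norm_radial (v : EuclideanSpace ℝ (Fin n)) :
    ‖radial v‖ = max 0 (min ‖v‖ (2 * ‖v‖ - 2)) := by
  rcases eq_or_ne v 0 with rfl | hv
  · simp [radial]
  · rw [radial, norm_smul, norm_div, norm_norm, div_mul_cancel₀ _ (norm_ne_zero_iff.2 hv),
      Real.norm_of_nonneg (le_max_left _ _)]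

theorem radial_of_norm_le_one {v : EuclideanSpace ℝ (Fin n)} (hv : ‖v‖ ≤ 1) : radial v = 0 := by
  rw [← norm_eq_zero, norm_radial, max_eq_left]
  exact (min_le_right _ _).trans (by linarith)

theorem radial_of_two_le_norm {v : EuclideanSpace ℝ (Fin n)} (hv : 2 ≤ ‖v‖) : radial v = v := by
  rw [radial, min_eq_left (by linarith), max_eq_right (norm_nonneg _), div_self (by linarith),
    one_smul]

theorem norm_radial_of_one_le {v : EuclideanSpace ℝ (Fin n)} (hv : 1 ≤ ‖v‖) :
    ‖radial v‖ = min ‖v‖ (2 * ‖v‖ - 2) := by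
  rw [norm_radial, max_eq_right (le_min (norm_nonneg _) (by linarith))]

theorem radial_eq_zero_iff {v : EuclideanSpace ℝ (Fin n)} : radial v = 0 ↔ ‖v‖ ≤ 1 := by
  refine ⟨fun h => ?_, radial_of_norm_le_one⟩
  by_contra hv
  rw [not_le] at hv
  have := norm_radial_of_one_le hv.le
  rw [h, norm_zero] at this
  rcases min_choice ‖v‖ (2 * ‖v‖ - 2) with h1 | h1 <;> linarith

theorem norm_radial_le_iff {v : EuclideanSpace ℝ (Fin n)} (hv : 1 ≤ ‖v‖) {r : ℝ} (hr : r ≤ 2) :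
    ‖radial v‖ ≤ r ↔ ‖v‖ ≤ 1 + r / 2 := by
  rw [norm_radial_of_one_le hv, min_le_iff]
  constructor
  · rintro (h | h) <;> linarith
  · intro h
    right
    linarith

theorem continuous_radial : Continuous (radial : EuclideanSpace ℝ (Fin n) → _) := by
  -- The numerator vanishes on the unit ball, so the denominator may be kept away from 0.
  have : (radial : EuclideanSpace ℝ (Fin n) → _) =
      fun v => (max 0 (min ‖v‖ (2 * ‖v‖ - 2)) / max ‖v‖ 1) • v := by
    funext v
    rcases le_total ‖v‖ 1 with h | h
    · rw [radial_of_norm_le_one h, max_eq_left ((min_le_right _ _).trans (by linarith))]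
      simp
    · rw [max_eq_left h]; rfl
  rw [this]
  have h1 : Continuous fun v : EuclideanSpace ℝ (Fin n) => max 0 (min ‖v‖ (2 * ‖v‖ - 2)) := by
    fun_prop
  refine (h1.div (continuous_norm.max continuous_const) fun v => ?_).smul continuous_id
  exact (lt_of_lt_of_le one_pos (le_max_right _ _)).ne'

theorem radial_injOn {v w : EuclideanSpace ℝ (Fin n)} (hv : 1 < ‖v‖) (hw : 1 < ‖w‖)
    (h : radial v = radial w) : v = w := by
  have h1 := congrArg norm h
  rw [norm_radial_of_one_le hv.le, norm_radial_of_one_le hw.le] at h1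
  have h2 : ‖v‖ = ‖w‖ := by
    rcases min_cases ‖v‖ (2 * ‖v‖ - 2) with h3 | h3 <;>
      rcases min_cases ‖w‖ (2 * ‖w‖ - 2) with h4 | h4 <;> linarith
  rw [radial, radial, h2] at h
  refine smul_right_injective _ ?_ h
  refine div_ne_zero ?_ (by linarith)
  refine (lt_of_lt_of_le ?_ (le_max_right _ _)).ne'
  exact lt_min (by linarith) (by linarith)

theorem exists_radial_eq (hn : 0 < n) (w : EuclideanSpace ℝ (Fin n)) :
    ∃ v : EuclideanSpace ℝ (Fin n), 1 ≤ ‖v‖ ∧ radial v = w := by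
  rcases eq_or_ne w 0 with rfl | hw
  -- The origin is hit from the unit sphere, which is nonempty only because `0 < n`.
  · refine ⟨EuclideanSpace.single ⟨0, hn⟩ 1, by simp, radial_of_norm_le_one (by simp)⟩
  · have hw' : 0 < ‖w‖ := norm_pos_iff.2 hw
    rcases le_total 2 ‖w‖ with h | h
    · exact ⟨w, by linarith, radial_of_two_le_norm h⟩
    -- `1 + s / 2` is the inverse of the stretching `r ↦ 2 * r - 2`.
    · refine ⟨((1 + ‖w‖ / 2) / ‖w‖) • w, ?_⟩
      have hnorm : ‖((1 + ‖w‖ / 2) / ‖w‖) • w‖ = 1 + ‖w‖ / 2 := by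
        rw [norm_smul, norm_div, norm_norm, div_mul_cancel₀ _ hw'.ne',
          Real.norm_of_nonneg (by positivity)]
      refine ⟨by rw [hnorm]; linarith, ?_⟩
      rw [radial, hnorm, min_eq_right (by linarith), max_eq_right (by linarith), smul_smul]
      have : (2 * (1 + ‖w‖ / 2) - 2) / (1 + ‖w‖ / 2) * ((1 + ‖w‖ / 2) / ‖w‖) = 1 := by
        field_simp
        ring
      rw [this, one_smul]

variable (e : CoordBall n M)

theorem isOpen_image_ball (r : ℝ) : IsOpen (e.emb '' ball 0 r) :=
  e.isOpenEmbedding.isOpenMap _ isOpen_ball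

theorem isCompact_image_closedBall (r : ℝ) : IsCompact (e.emb '' closedBall 0 r) :=
  (isCompact_closedBall 0 r).image e.isOpenEmbedding.continuous

theorem isClosed_image_closedBall [T2Space M] (r : ℝ) : IsClosed (e.emb '' closedBall 0 r) :=
  (e.isCompact_image_closedBall r).isClosed

theorem isClosed_complBall : IsClosed e.complBall := (e.isOpen_image_ball 1).isClosed_compl

theorem emb_mem_image_iff {s : Set (EuclideanSpace ℝ (Fin n))} {v : EuclideanSpace ℝ (Fin n)} :
    e.emb v ∈ e.emb '' s ↔ v ∈ s := e.isOpenEmbedding.injective.mem_set_image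

theorem emb_mem_complBall {v : EuclideanSpace ℝ (Fin n)} : e.emb v ∈ e.complBall ↔ 1 ≤ ‖v‖ := by
  rw [complBall, mem_compl_iff, emb_mem_image_iff, mem_ball_zero_iff, not_lt]

theorem image_ball_subset {r s : ℝ} (h : r ≤ s) : e.emb '' ball 0 r ⊆ e.emb '' ball 0 s :=
  image_mono (ball_subset_ball h)

theorem center_mem_image_ball {r : ℝ} (hr : 0 < r) : e.center ∈ e.emb '' ball 0 r :=
  ⟨0, by simpa, rfl⟩

/-- Gluing a map on the coordinate neighbourhood to a map defined everywhere. -/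
theorem continuous_extend [T2Space M] {Y : Type*} [TopologicalSpace Y]
    {h : EuclideanSpace ℝ (Fin n) → Y} {g : M → Y} (hh : Continuous h) (hg : Continuous g)
    (hgh : ∀ v, 2 ≤ ‖v‖ → h v = g (e.emb v)) : Continuous (Function.extend e.emb h g) := by
  have hinj := e.isOpenEmbedding.injective
  have hA : ContinuousOn (Function.extend e.emb h g) (e.emb '' closedBall 0 2) := by
    refine ContinuousOn.of_comp_isCompact (isCompact_closedBall 0 2)
      e.isOpenEmbedding.continuous.continuousOn ?_
    exact hh.continuousOn.congr fun v _ => hinj.extend_apply h g v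
  have hB : ContinuousOn (Function.extend e.emb h g) (e.emb '' ball 0 2)ᶜ := by
    refine hg.continuousOn.congr fun x hx => ?_
    by_cases hx' : ∃ v, e.emb v = x
    · obtain ⟨v, rfl⟩ := hx'
      rw [hinj.extend_apply, hgh v]
      rwa [mem_compl_iff, emb_mem_image_iff, mem_ball_zero_iff, not_lt] at hx
    · exact Function.extend_apply' _ _ _ hx'
  rw [← continuousOn_univ]
  refine (hA.union_of_isClosed hB (e.isClosed_image_closedBall 2)
    (e.isOpen_image_ball 2).isClosed_compl).mono fun x _ => ?_
  by_cases hx : x ∈ e.emb '' ball 0 2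
  · exact Or.inl (image_mono ball_subset_closedBall hx)
  · exact Or.inr hx

theorem shrink_emb (v : EuclideanSpace ℝ (Fin n)) : e.shrink (e.emb v) = e.emb (radial v) :=
  e.isOpenEmbedding.injective.extend_apply _ _ _

theorem shrink_of_notMem_range {x : M} (hx : x ∉ range e.emb) : e.shrink x = x :=
  Function.extend_apply' _ _ _ hx

theorem shrink_of_notMem_ball {x : M} (hx : x ∉ e.emb '' ball 0 2) : e.shrink x = x := by
  by_cases hx' : x ∈ range e.emb
  · obtain ⟨v, rfl⟩ := hx'
    rw [shrink_emb, radial_of_two_le_norm]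
    rwa [emb_mem_image_iff, mem_ball_zero_iff, not_lt] at hx
  · exact e.shrink_of_notMem_range hx'

theorem continuous_shrink [T2Space M] : Continuous e.shrink :=
  e.continuous_extend (e.isOpenEmbedding.continuous.comp continuous_radial) continuous_id
    fun v hv => by simp [radial_of_two_le_norm hv]

/-- The map is the identity off the ball of radius 2, and the closed ball of that radius is compact.
-/
theorem isClosedMap_shrink [T2Space M] : IsClosedMap e.shrink := by
  intro Z hZ
  have : e.shrink '' Z = e.shrink '' (e.emb '' closedBall 0 2 ∩ Z) ∪ (Z ∩ (e.emb '' ball 0 2)ᶜ) := by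
    ext y
    constructor
    · rintro ⟨x, hx, rfl⟩
      by_cases hxb : x ∈ e.emb '' ball 0 2
      · exact Or.inl ⟨x, ⟨image_mono ball_subset_closedBall hxb, hx⟩, rfl⟩
      · right
        rw [e.shrink_of_notMem_ball hxb]
        exact ⟨hx, hxb⟩
    · rintro (⟨x, hx, rfl⟩ | ⟨hy, hyb⟩)
      · exact ⟨x, hx.2, rfl⟩
      · exact ⟨y, hy, e.shrink_of_notMem_ball hyb⟩
  rw [this]
  exact (((e.isCompact_image_closedBall 2).inter_right hZ).image e.continuous_shrink).isClosed.union
    (hZ.inter (e.isOpen_image_ball 2).isClosed_compl)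

theorem exists_of_shrink_eq_emb {x : M} {w : EuclideanSpace ℝ (Fin n)}
    (h : e.shrink x = e.emb w) : ∃ v, x = e.emb v ∧ radial v = w := by
  by_cases hx : x ∈ range e.emb
  · obtain ⟨v, rfl⟩ := hx
    rw [shrink_emb] at h
    exact ⟨v, rfl, e.isOpenEmbedding.injective h⟩
  · rw [e.shrink_of_notMem_range hx] at h
    exact absurd ⟨w, h.symm⟩ hx

theorem exists_of_shrink_eq_center {x : M} (hx : x ∈ e.complBall) (h : e.shrink x = e.center) :
    ∃ v, x = e.emb v ∧ ‖v‖ = 1 := by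
  obtain ⟨v, rfl, hv⟩ := e.exists_of_shrink_eq_emb h
  exact ⟨v, rfl, le_antisymm (radial_eq_zero_iff.1 hv) (e.emb_mem_complBall.1 hx)⟩

theorem shrink_injOn {x y : M} (hx : x ∈ e.complBall) (hy : y ∈ e.complBall)
    (h : e.shrink x = e.shrink y) (hc : e.shrink x ≠ e.center) : x = y := by
  by_cases hxr : x ∈ range e.emb
  · obtain ⟨v, rfl⟩ := hxr
    rw [shrink_emb] at h hc
    obtain ⟨w, rfl, hw⟩ := e.exists_of_shrink_eq_emb h.symm
    have hv1 : radial v ≠ 0 := fun h0 => hc (by rw [h0]; rfl)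
    have hv2 : 1 < ‖v‖ := by
      by_contra hv
      exact hv1 (radial_eq_zero_iff.2 (not_lt.1 hv))
    have hw2 : 1 < ‖w‖ := by
      by_contra hw'
      exact hv1 (hw ▸ radial_eq_zero_iff.2 (not_lt.1 hw'))
    rw [radial_injOn hv2 hw2 hw.symm]
  · rw [e.shrink_of_notMem_range hxr] at h
    by_cases hyr : y ∈ range e.emb
    · obtain ⟨w, rfl⟩ := hyr
      rw [shrink_emb] at h
      exact absurd ⟨_, h.symm⟩ hxr
    · rwa [e.shrink_of_notMem_range hyr] at h

theorem exists_shrink_eq (hn : 0 < n) (z : M) : ∃ x ∈ e.complBall, e.shrink x = z := by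
  by_cases hz : z ∈ range e.emb
  · obtain ⟨w, rfl⟩ := hz
    obtain ⟨v, hv, rfl⟩ := exists_radial_eq hn w
    exact ⟨e.emb v, e.emb_mem_complBall.2 hv, e.shrink_emb v⟩
  · exact ⟨z, fun h => hz (image_subset_range _ _ h), e.shrink_of_notMem_range hz⟩

/-- A map to `ℝⁿ` which is the coordinate on the unit sphere. -/
def coord : M → EuclideanSpace ℝ (Fin n) :=
  Function.extend e.emb (fun v => max 0 (2 - ‖v‖) • v) 0

theorem continuous_coord [T2Space M] : Continuous e.coord :=
  e.continuous_extend (by fun_prop) continuous_zero fun v hv => by simp [hv]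

theorem coord_emb {v : EuclideanSpace ℝ (Fin n)} (hv : ‖v‖ = 1) : e.coord (e.emb v) = v := by
  rw [coord, e.isOpenEmbedding.injective.extend_apply, hv]
  norm_num

end CoordBall

/-! ### The connected sum and the fibres of the smash map -/

namespace ConnectedSum

variable {n : ℕ} {M M' : Type*} [TopologicalSpace M] [TopologicalSpace M']
  (e : CoordBall n M) (e' : CoordBall n M')

/-- The inclusion of the part of `M # M'` coming from `M`. -/
def inl (x : e.complBall) : ConnectedSum e e' := Quot.mk _ (Sum.inl x)

/-- The inclusion of the part of `M # M'` coming from `M'`. -/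
def inr (y : e'.complBall) : ConnectedSum e e' := Quot.mk _ (Sum.inr y)

theorem continuous_inl : Continuous (inl e e') := continuous_quot_mk.comp _root_.continuous_inl

theorem continuous_inr : Continuous (inr e e') := continuous_quot_mk.comp _root_.continuous_inr

variable {e e'}

theorem inl_eq_inr {v : EuclideanSpace ℝ (Fin n)} (hv : ‖v‖ = 1) (h : e.emb v ∈ e.complBall)
    (h' : e'.emb v ∈ e'.complBall) : inl e e' ⟨e.emb v, h⟩ = inr e e' ⟨e'.emb v, h'⟩ :=
  Quot.sound (Rel.glue v hv h h')

theorem exists_inl_or_inr (x : ConnectedSum e e') :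
    (∃ a, x = inl e e' a) ∨ ∃ b, x = inr e e' b := by
  obtain ⟨a | b, rfl⟩ := Quot.exists_rep x
  exacts [Or.inl ⟨a, rfl⟩, Or.inr ⟨b, rfl⟩]

theorem continuous_iff {Y : Type*} [TopologicalSpace Y] {f : ConnectedSum e e' → Y} :
    Continuous f ↔ Continuous (f ∘ inl e e') ∧ Continuous (f ∘ inr e e') := by
  refine ⟨fun h => ⟨h.comp (continuous_inl e e'), h.comp (continuous_inr e e')⟩, fun h => ?_⟩
  exact (isQuotientMap_quot_mk (r := Rel e e')).continuous_iff.2 (continuous_sum_dom.2 h)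

variable (e e')

theorem smash_inl (a : e.complBall) :
    (smash e e' (inl e e' a)).1 = (e.shrink a, e'.center) := rfl

theorem smash_inr (b : e'.complBall) :
    (smash e e' (inr e e' b)).1 = (e.center, e'.shrink b) := rfl

theorem collapse_eq_fst_smash (x : ConnectedSum e e') : collapse e e' x = (smash e e' x).1.1 := by
  rcases exists_inl_or_inr x with ⟨a, rfl⟩ | ⟨b, rfl⟩ <;> rfl

/-- The base point of the wedge. -/
def basePoint : Wedge e.center e'.center := ⟨(e.center, e'.center), Or.inl rfl⟩

variable {e e'}

theorem exists_of_smash_eq_basePoint {x : ConnectedSum e e'} (h : smash e e' x = basePoint e e') :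
    ∃ v, ‖v‖ = 1 ∧ ∃ h, x = inl e e' ⟨e.emb v, h⟩ := by
  rcases exists_inl_or_inr x with ⟨a, rfl⟩ | ⟨b, rfl⟩
  · obtain ⟨v, hv, hv1⟩ := e.exists_of_shrink_eq_center a.2 (congrArg (fun w => w.1.1) h)
    exact ⟨v, hv1, hv ▸ a.2, congrArg _ (Subtype.ext hv)⟩
  · obtain ⟨v, hv, hv1⟩ := e'.exists_of_shrink_eq_center b.2 (congrArg (fun w => w.1.2) h)
    refine ⟨v, hv1, e.emb_mem_complBall.2 hv1.ge, ?_⟩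
    rw [inl_eq_inr hv1 _ (e'.emb_mem_complBall.2 hv1.ge)]
    exact congrArg _ (Subtype.ext hv)

/-- On each half this is the injectivity of the shrinking map; the two halves have images meeting
only in the base point. -/
theorem smash_injOn {x y : ConnectedSum e e'} (h : smash e e' x = smash e e' y)
    (hx : smash e e' x ≠ basePoint e e') : x = y := by
  have h1 := congrArg (fun w => w.1.1) h
  have h2 := congrArg (fun w => w.1.2) h
  rcases exists_inl_or_inr x with ⟨a, rfl⟩ | ⟨b, rfl⟩ <;>
    rcases exists_inl_or_inr y with ⟨a', rfl⟩ | ⟨b', rfl⟩ <;>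
    simp only [smash_inl, smash_inr] at h1 h2
  · refine congrArg _ (Subtype.ext (e.shrink_injOn a.2 a'.2 h1 fun hc => hx ?_))
    exact Subtype.ext (Prod.ext hc rfl)
  · exact (hx (Subtype.ext (Prod.ext h1 rfl))).elim
  · exact (hx (Subtype.ext (Prod.ext rfl h2))).elim
  · refine congrArg _ (Subtype.ext (e'.shrink_injOn b.2 b'.2 h2 fun hc => hx ?_))
    exact Subtype.ext (Prod.ext rfl hc)

variable (e e')

theorem smash_surjective (hn : 0 < n) : Function.Surjective (smash e e') := by
  rintro ⟨⟨m, m'⟩, h⟩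
  rcases h with h | h
  · obtain ⟨b, hb, rfl⟩ := e'.exists_shrink_eq hn m'
    exact ⟨inr e e' ⟨b, hb⟩, Subtype.ext (Prod.ext h.symm rfl)⟩
  · obtain ⟨a, ha, rfl⟩ := e.exists_shrink_eq hn m
    exact ⟨inl e e' ⟨a, ha⟩, Subtype.ext (Prod.ext rfl h.symm)⟩

/-- A map to `ℝⁿ` which separates the points of the gluing sphere. -/
def coord : ConnectedSum e e' → EuclideanSpace ℝ (Fin n) :=
  Quot.lift (Sum.elim (fun a => e.coord a) (fun b => e'.coord b)) <| by
    rintro _ _ ⟨v, hv, h, h'⟩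
    simp [e.coord_emb hv, e'.coord_emb hv]

theorem coord_inl {v : EuclideanSpace ℝ (Fin n)} (hv : ‖v‖ = 1) (h : e.emb v ∈ e.complBall) :
    coord e e' (inl e e' ⟨e.emb v, h⟩) = v := e.coord_emb hv

variable [T2Space M] [T2Space M']

theorem continuous_smash : Continuous (smash e e') := by
  refine continuous_iff.2 ⟨?_, ?_⟩
  · exact Continuous.subtype_mk ((e.continuous_shrink.comp continuous_subtype_val).prodMk
      continuous_const) _
  · exact Continuous.subtype_mk (continuous_const.prodMk
      (e'.continuous_shrink.comp continuous_subtype_val)) _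

theorem isClosedMap_smash : IsClosedMap (smash e e') := by
  intro Z hZ
  have hA : IsClosed (e.shrink '' (Subtype.val '' (inl e e' ⁻¹' Z))) :=
    e.isClosedMap_shrink _ (e.isClosed_complBall.isClosedEmbedding_subtypeVal.isClosedMap _
      (hZ.preimage (continuous_inl e e')))
  have hB : IsClosed (e'.shrink '' (Subtype.val '' (inr e e' ⁻¹' Z))) :=
    e'.isClosedMap_shrink _ (e'.isClosed_complBall.isClosedEmbedding_subtypeVal.isClosedMap _
      (hZ.preimage (continuous_inr e e')))
  have h1 : Continuous fun w : Wedge e.center e'.center => w.1.1 := by fun_prop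
  have h2 : Continuous fun w : Wedge e.center e'.center => w.1.2 := by fun_prop
  convert! ((hA.preimage h1).inter (isClosed_singleton (x := e'.center).preimage h2)).union
    ((isClosed_singleton (x := e.center).preimage h1).inter (hB.preimage h2)) using 1
  ext w
  constructor
  · rintro ⟨x, hx, rfl⟩
    rcases exists_inl_or_inr x with ⟨a, rfl⟩ | ⟨b, rfl⟩
    · exact Or.inl ⟨⟨a, ⟨a, hx, rfl⟩, rfl⟩, rfl⟩
    · exact Or.inr ⟨rfl, ⟨b, ⟨b, hx, rfl⟩, rfl⟩⟩
  · rintro (⟨⟨_, ⟨a, ha, rfl⟩, h⟩, h'⟩ | ⟨h', ⟨_, ⟨b, hb, rfl⟩, h⟩⟩)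
    · exact ⟨_, ha, Subtype.ext (Prod.ext h h'.symm)⟩
    · exact ⟨_, hb, Subtype.ext (Prod.ext h'.symm h)⟩

theorem continuous_coord : Continuous (coord e e') :=
  continuous_iff.2 ⟨e.continuous_coord.comp continuous_subtype_val,
    e'.continuous_coord.comp continuous_subtype_val⟩

/-- The smash map separates all points except those of the gluing sphere, and `coord` separates
these, so together they inject into a Hausdorff space. -/
instance : T2Space (ConnectedSum e e') := by
  refine T2Space.of_injective_continuous (f := fun x => (smash e e' x, coord e e' x)) ?_
    ((continuous_smash e e').prodMk (continuous_coord e e'))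
  intro x y hxy
  obtain ⟨h1, h2⟩ := Prod.mk.inj hxy
  by_cases hx : smash e e' x = basePoint e e'
  · obtain ⟨u, hu, hu', rfl⟩ := exists_of_smash_eq_basePoint hx
    obtain ⟨v, hv, hv', rfl⟩ := exists_of_smash_eq_basePoint (h1 ▸ hx)
    rw [coord_inl e e' hu, coord_inl e e' hv] at h2
    subst h2
    rfl
  · exact smash_injOn h1 hx

end ConnectedSum

/-- Where fibres are single points, the preimage of a closed set under the section is its image
under `f`. -/
theorem IsClosedMap.continuousOn_surjInv {X Y : Type*} [TopologicalSpace X] [TopologicalSpace Y]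
    {f : X → Y} (hf : IsClosedMap f) (hs : Function.Surjective f) {S : Set Y}
    (hinj : ∀ x y, f x = f y → f x ∈ S → x = y) : ContinuousOn (Function.surjInv hs) S := by
  rw [continuousOn_iff_isClosed]
  intro Z hZ
  refine ⟨f '' Z, hf Z hZ, ?_⟩
  ext y
  constructor
  · rintro ⟨hy, hyS⟩
    exact ⟨⟨_, hy, Function.surjInv_eq hs y⟩, hyS⟩
  · rintro ⟨⟨x, hx, rfl⟩, hyS⟩
    refine ⟨?_, hyS⟩
    have := hinj _ _ (Function.surjInv_eq hs (f x)) (by rwa [Function.surjInv_eq hs])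
    rwa [mem_preimage, this]

/-! ### The neck as a punctured Euclidean space -/

section Inversion

variable {E : Type*} [NormedAddCommGroup E] [NormedSpace ℝ E]

/-- Inversion in the unit sphere. -/
def sphereInv (v : E) : E := (‖v‖ ^ 2)⁻¹ • v

theorem norm_sphereInv (v : E) : ‖sphereInv v‖ = ‖v‖⁻¹ := by
  rcases eq_or_ne v 0 with rfl | hv
  · simp [sphereInv]
  · have := norm_ne_zero_iff.2 hv
    rw [sphereInv, norm_smul, norm_inv, norm_pow, norm_norm]
    field_simp

theorem sphereInv_sphereInv (v : E) : sphereInv (sphereInv v) = v := by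
  rcases eq_or_ne v 0 with rfl | hv
  · simp [sphereInv]
  · have := norm_ne_zero_iff.2 hv
    rw [sphereInv, norm_sphereInv, sphereInv, smul_smul, inv_pow, inv_inv, mul_inv_cancel₀
      (pow_ne_zero 2 this), one_smul]

theorem sphereInv_of_norm_eq_one {v : E} (hv : ‖v‖ = 1) : sphereInv v = v := by
  simp [sphereInv, hv]

theorem continuous_sphereInv : Continuous fun v : {v : E // v ≠ 0} => sphereInv v.1 := by
  refine Continuous.smul (Continuous.inv₀ (by fun_prop) fun v => ?_) continuous_subtype_val
  exact pow_ne_zero 2 (norm_ne_zero_iff.2 v.2)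

theorem one_le_norm_sphereInv {v : E} (hv : v ≠ 0) (h : ‖v‖ ≤ 1) : 1 ≤ ‖sphereInv v‖ := by
  rw [norm_sphereInv]
  exact (one_le_inv₀ (norm_pos_iff.2 hv)).2 h

end Inversion

namespace ConnectedSum

open CoordBall

variable {n : ℕ} {M M' : Type*} [TopologicalSpace M] [TopologicalSpace M']
  (e : CoordBall n M) (e' : CoordBall n M')

/-- The neck of the connected sum, parametrized by the punctured Euclidean space. -/
def neck (v : {v : EuclideanSpace ℝ (Fin n) // v ≠ 0}) : ConnectedSum e e' :=
  if h : 1 ≤ ‖v.1‖ then inl e e' ⟨e.emb v, e.emb_mem_complBall.2 h⟩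
  else inr e e' ⟨e'.emb (sphereInv v.1),
    e'.emb_mem_complBall.2 (one_le_norm_sphereInv v.2 (not_le.1 h).le)⟩

theorem neck_of_one_le {v : {v : EuclideanSpace ℝ (Fin n) // v ≠ 0}} (h : 1 ≤ ‖v.1‖) :
    neck e e' v = inl e e' ⟨e.emb v, e.emb_mem_complBall.2 h⟩ := dif_pos h

theorem neck_of_le_one {v : {v : EuclideanSpace ℝ (Fin n) // v ≠ 0}} (h : ‖v.1‖ ≤ 1) :
    neck e e' v = inr e e' ⟨e'.emb (sphereInv v.1),
      e'.emb_mem_complBall.2 (one_le_norm_sphereInv v.2 h)⟩ := by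
  rcases h.eq_or_lt with h1 | h1
  · rw [neck_of_one_le e e' h1.ge, inl_eq_inr h1 _ (e'.emb_mem_complBall.2 h1.ge)]
    exact congrArg (inr e e') (Subtype.ext (congrArg e'.emb (sphereInv_of_norm_eq_one h1).symm))
  · exact dif_neg (not_le.2 h1)

theorem continuous_neck : Continuous (neck e e') := by
  have hA : ContinuousOn (neck e e') {v | 1 ≤ ‖v.1‖} := by
    rw [continuousOn_iff_continuous_domRestrict]
    have : Continuous fun v : {v : {v : EuclideanSpace ℝ (Fin n) // v ≠ 0} | 1 ≤ ‖v.1‖} =>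
        inl e e' ⟨e.emb v.1.1, e.emb_mem_complBall.2 v.2⟩ :=
      (continuous_inl e e').comp (Continuous.subtype_mk (e.isOpenEmbedding.continuous.comp
        (continuous_subtype_val.comp continuous_subtype_val)) _)
    exact this.congr fun v => (neck_of_one_le e e' v.2).symm
  have hB : ContinuousOn (neck e e') {v | ‖v.1‖ ≤ 1} := by
    rw [continuousOn_iff_continuous_domRestrict]
    have : Continuous fun v : {v : {v : EuclideanSpace ℝ (Fin n) // v ≠ 0} | ‖v.1‖ ≤ 1} =>
        inr e e' ⟨e'.emb (sphereInv v.1.1),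
          e'.emb_mem_complBall.2 (one_le_norm_sphereInv v.1.2 v.2)⟩ :=
      (continuous_inr e e').comp (Continuous.subtype_mk (e'.isOpenEmbedding.continuous.comp
        (continuous_sphereInv.comp continuous_subtype_val)) _)
    exact this.congr fun v => (neck_of_le_one e e' v.2).symm
  rw [← continuousOn_univ]
  refine (hA.union_of_isClosed hB (isClosed_le (by fun_prop) (by fun_prop))
    (isClosed_le (by fun_prop) (by fun_prop))).mono fun v _ => le_total 1 ‖v.1‖

theorem smash_neck_of_one_le {v : {v : EuclideanSpace ℝ (Fin n) // v ≠ 0}} (h : 1 ≤ ‖v.1‖) :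
    (smash e e' (neck e e' v)).1 = (e.emb (radial v.1), e'.center) := by
  rw [neck_of_one_le e e' h, smash_inl, e.shrink_emb]

theorem smash_neck_of_le_one {v : {v : EuclideanSpace ℝ (Fin n) // v ≠ 0}} (h : ‖v.1‖ ≤ 1) :
    (smash e e' (neck e e' v)).1 = (e.center, e'.emb (radial (sphereInv v.1))) := by
  rw [neck_of_le_one e e' h, smash_inr, e'.shrink_emb]

/-- The smash map tells whether the norm is below, equal to or above 1. Off the unit sphere it also
determines the point; on the sphere `coord` does. -/
theorem neck_injective : Function.Injective (neck e e') := by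
  intro u v huv
  have hs := congrArg (fun x => (smash e e' x).1) huv
  have hinv : ∀ w : {v : EuclideanSpace ℝ (Fin n) // v ≠ 0}, ‖w.1‖ < 1 → 1 < ‖sphereInv w.1‖ := by
    intro w hw
    rw [norm_sphereInv]
    exact (one_lt_inv₀ (norm_pos_iff.2 w.2)).2 hw
  have hrad : ∀ w : EuclideanSpace ℝ (Fin n), 1 < ‖w‖ → radial w ≠ 0 := fun w hw h =>
    absurd (radial_eq_zero_iff.1 h) (not_le.2 hw)
  have hfst : ∀ w : {v : EuclideanSpace ℝ (Fin n) // v ≠ 0},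
      1 < ‖w.1‖ ↔ (smash e e' (neck e e' w)).1.1 ≠ e.center := by
    intro w
    rcases lt_or_ge 1 ‖w.1‖ with h | h
    · rw [smash_neck_of_one_le e e' h.le]
      exact ⟨fun _ hc => hrad _ h (e.isOpenEmbedding.injective hc), fun _ => h⟩
    · rw [smash_neck_of_le_one e e' h]
      exact ⟨fun h' => absurd h (not_le.2 h'), fun h' => absurd rfl h'⟩
  have hsnd : ∀ w : {v : EuclideanSpace ℝ (Fin n) // v ≠ 0},
      ‖w.1‖ < 1 ↔ (smash e e' (neck e e' w)).1.2 ≠ e'.center := by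
    intro w
    rcases lt_or_ge ‖w.1‖ 1 with h | h
    · rw [smash_neck_of_le_one e e' h.le]
      exact ⟨fun _ hc => hrad _ (hinv w h) (e'.isOpenEmbedding.injective hc), fun _ => h⟩
    · rw [smash_neck_of_one_le e e' h]
      exact ⟨fun h' => absurd h (not_le.2 h'), fun h' => absurd rfl h'⟩
  rcases lt_trichotomy ‖u.1‖ 1 with hu | hu | hu
  · have hv : ‖v.1‖ < 1 := by rw [hsnd, ← huv, ← hsnd]; exact hu
    simp only [smash_neck_of_le_one e e' hu.le, smash_neck_of_le_one e e' hv.le] at hs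
    have h1 := radial_injOn (hinv u hu) (hinv v hv)
      (e'.isOpenEmbedding.injective (Prod.mk.inj hs).2)
    exact Subtype.ext (by rw [← sphereInv_sphereInv u.1, h1, sphereInv_sphereInv])
  · have hv : ‖v.1‖ = 1 := by
      refine le_antisymm (not_lt.1 ?_) (not_lt.1 ?_)
      · rw [hfst, ← huv, ← hfst]; exact hu.not_gt
      · rw [hsnd, ← huv, ← hsnd]; exact hu.not_lt
    have h1 := congrArg (coord e e') huv
    rw [neck_of_one_le e e' hu.ge, neck_of_one_le e e' hv.ge, coord_inl e e' hu,
      coord_inl e e' hv] at h1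
    exact Subtype.ext h1
  · have hv : 1 < ‖v.1‖ := by rw [hfst, ← huv, ← hfst]; exact hu
    simp only [smash_neck_of_one_le e e' hu.le, smash_neck_of_one_le e e' hv.le] at hs
    exact Subtype.ext (radial_injOn hu hv (e.isOpenEmbedding.injective (Prod.mk.inj hs).1))

/-- The open neighbourhood of radius `r` of the base point in the wedge. -/
def wedgeBall (r : ℝ) : Set (Wedge e.center e'.center) :=
  {w | w.1.1 ∈ e.emb '' ball 0 r ∧ w.1.2 ∈ e'.emb '' ball 0 r}

/-- The closed neighbourhood of radius `r` of the base point in the wedge. -/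
def wedgeClosedBall (r : ℝ) : Set (Wedge e.center e'.center) :=
  {w | w.1.1 ∈ e.emb '' closedBall 0 r ∧ w.1.2 ∈ e'.emb '' closedBall 0 r}

theorem wedgeBall_subset_wedgeClosedBall (r : ℝ) : wedgeBall e e' r ⊆ wedgeClosedBall e e' r :=
  fun _ h => ⟨image_mono ball_subset_closedBall h.1, image_mono ball_subset_closedBall h.2⟩

theorem wedgeClosedBall_subset_wedgeBall {r s : ℝ} (h : r < s) :
    wedgeClosedBall e e' r ⊆ wedgeBall e e' s :=
  fun _ hw => ⟨image_mono (closedBall_subset_ball h) hw.1, image_mono (closedBall_subset_ball h) hw.2⟩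

theorem isOpen_wedgeBall (r : ℝ) : IsOpen (wedgeBall e e' r) :=
  ((e.isOpen_image_ball r).preimage (by fun_prop)).inter
    ((e'.isOpen_image_ball r).preimage (by fun_prop))

theorem isClosed_wedgeClosedBall [T2Space M] [T2Space M'] (r : ℝ) :
    IsClosed (wedgeClosedBall e e' r) :=
  ((e.isClosed_image_closedBall r).preimage (by fun_prop)).inter
    ((e'.isClosed_image_closedBall r).preimage (by fun_prop))

theorem basePoint_mem_wedgeBall {r : ℝ} (hr : 0 < r) : basePoint e e' ∈ wedgeBall e e' r :=
  ⟨e.center_mem_image_ball hr, e'.center_mem_image_ball hr⟩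

/-- For `r ≤ 2`, stretching takes the sphere of radius `1 + r / 2` to that of radius `r`. Inversion
gives the reciprocal bound on the `M'` side, so the part over the closed ball is a compact annulus.
-/
theorem smash_neck_mem_iff {r : ℝ} (hr : 0 < r) (hr2 : r ≤ 2)
    (v : {v : EuclideanSpace ℝ (Fin n) // v ≠ 0}) :
    smash e e' (neck e e' v) ∈ wedgeClosedBall e e' r ↔ ‖v.1‖ ∈ Icc (1 + r / 2)⁻¹ (1 + r / 2) := by
  have hv : 0 < ‖v.1‖ := norm_pos_iff.2 v.2
  have h1 : (1 : ℝ) ≤ 1 + r / 2 := by linarith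
  have h1' : (1 + r / 2)⁻¹ ≤ 1 := inv_le_one_of_one_le₀ h1
  have hc : e.center ∈ e.emb '' closedBall 0 r := ⟨0, by simpa using hr.le, rfl⟩
  have hc' : e'.center ∈ e'.emb '' closedBall 0 r := ⟨0, by simpa using hr.le, rfl⟩
  rcases le_total 1 ‖v.1‖ with h | h
  · rw [wedgeClosedBall, mem_ofPred_eq, smash_neck_of_one_le e e' h, emb_mem_image_iff,
      mem_closedBall_zero_iff, norm_radial_le_iff h hr2, mem_Icc]
    exact ⟨fun h2 => ⟨h1'.trans h, h2.1⟩, fun h2 => ⟨h2.2, hc'⟩⟩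
  · rw [wedgeClosedBall, mem_ofPred_eq, smash_neck_of_le_one e e' h, emb_mem_image_iff,
      mem_closedBall_zero_iff, norm_radial_le_iff (one_le_norm_sphereInv v.2 h) hr2, mem_Icc,
      norm_sphereInv, inv_le_comm₀ hv (by linarith)]
    exact ⟨fun h2 => ⟨h2.2, h.trans h1⟩, fun h2 => ⟨hc, h2.1⟩⟩

theorem exists_neck_eq {r : ℝ} {x : ConnectedSum e e'} (hx : smash e e' x ∈ wedgeClosedBall e e' r) :
    ∃ v, neck e e' v = x := by
  have hx1 : (smash e e' x).1.1 ∈ range e.emb := image_subset_range _ _ hx.1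
  have hx2 : (smash e e' x).1.2 ∈ range e'.emb := image_subset_range _ _ hx.2
  rcases exists_inl_or_inr x with ⟨a, rfl⟩ | ⟨b, rfl⟩
  · rw [smash_inl] at hx1
    obtain ⟨w, hw⟩ := hx1
    obtain ⟨v, hv, -⟩ := e.exists_of_shrink_eq_emb (x := a) hw.symm
    have hv1 : 1 ≤ ‖v‖ := by
      rw [← e.emb_mem_complBall, ← hv]
      exact a.2
    have hv0 : v ≠ 0 := norm_ne_zero_iff.1 (one_pos.trans_le hv1).ne'
    refine ⟨⟨v, hv0⟩, ?_⟩
    obtain rfl : a = ⟨e.emb v, e.emb_mem_complBall.2 hv1⟩ := Subtype.ext hv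
    exact neck_of_one_le e e' (v := ⟨v, hv0⟩) hv1
  · rw [smash_inr] at hx2
    obtain ⟨w, hw⟩ := hx2
    obtain ⟨v, hv, -⟩ := e'.exists_of_shrink_eq_emb (x := b) hw.symm
    have hv1 : 1 ≤ ‖v‖ := by
      rw [← e'.emb_mem_complBall, ← hv]
      exact b.2
    have h1 : ‖sphereInv v‖ ≤ 1 := by
      rw [norm_sphereInv]
      exact inv_le_one_of_one_le₀ hv1
    have h0 : sphereInv v ≠ 0 := by
      rw [← norm_ne_zero_iff, norm_sphereInv]
      exact inv_ne_zero (one_pos.trans_le hv1).ne'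
    refine ⟨⟨sphereInv v, h0⟩, ?_⟩
    rw [neck_of_le_one e e' (v := ⟨sphereInv v, h0⟩) h1]
    exact congrArg (inr e e') (Subtype.ext ((congrArg e'.emb (sphereInv_sphereInv v)).trans hv.symm))

/-- Coordinates on the neck. -/
def neckCoord : ConnectedSum e e' → EuclideanSpace ℝ (Fin n) :=
  Function.extend (neck e e') Subtype.val 0

theorem neckCoord_neck (v : {v : EuclideanSpace ℝ (Fin n) // v ≠ 0}) :
    neckCoord e e' (neck e e' v) = v.1 := (neck_injective e e').extend_apply _ _ _

variable [T2Space M] [T2Space M']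

theorem continuousOn_neckCoord {r : ℝ} (hr : 0 < r) (hr2 : r ≤ 2) :
    ContinuousOn (neckCoord e e') (smash e e' ⁻¹' wedgeClosedBall e e' r) := by
  set A : Set {v : EuclideanSpace ℝ (Fin n) // v ≠ 0} :=
    {v | ‖v.1‖ ∈ Icc (1 + r / 2)⁻¹ (1 + r / 2)}
  have hA : IsCompact A := by
    rw [Subtype.isCompact_iff]
    have : Subtype.val '' A = {v : EuclideanSpace ℝ (Fin n) | ‖v‖ ∈ Icc (1 + r / 2)⁻¹ (1 + r / 2)} := by
      ext v
      constructor
      · rintro ⟨w, hw, rfl⟩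
        exact hw
      · intro hv
        have : 0 < (1 + r / 2)⁻¹ := by positivity
        exact ⟨⟨v, norm_ne_zero_iff.1 (this.trans_le hv.1).ne'⟩, hv, rfl⟩
    rw [this]
    refine (isCompact_closedBall (0 : EuclideanSpace ℝ (Fin n)) (1 + r / 2)).of_isClosed_subset
      (isClosed_Icc.preimage continuous_norm) fun v hv => ?_
    simpa using hv.2
  refine (ContinuousOn.of_comp_isCompact hA (continuous_neck e e').continuousOn
    (f := neckCoord e e') ?_).mono ?_
  · exact continuous_subtype_val.continuousOn.congr fun v _ => neckCoord_neck e e' v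
  · intro x hx
    obtain ⟨v, rfl⟩ := exists_neck_eq e e' hx
    exact ⟨v, (smash_neck_mem_iff e e' hr hr2 v).1 hx, rfl⟩

/-- Off the open ball the lift must be `τ ∘ α`. Over the closed ball, the values already known, on
the boundary of the cube and on the overlap of the two regions, lie in an annulus whose dimension
exceeds that of the cube, so they extend. -/
theorem cellExtension_smash {m : ℕ} (hm : m < n) {r : ℝ} (hr : 0 < r) (hr2 : r ≤ 2) :
    CellExtension m
      (fun x w => smash e e' x = w ∨ smash e e' x ∈ wedgeBall e e' r ∧ w ∈ wedgeBall e e' r)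
      (fun x w => smash e e' x = w ∨
        smash e e' x ∈ wedgeClosedBall e e' r ∧ w ∈ wedgeClosedBall e e' r) := by
  classical
  intro α hα β₀ hβ₀ hR
  have hsurj := smash_surjective e e' (by omega)
  set τ := Function.surjInv hsurj with hτ
  have hqτ : ∀ w, smash e e' (τ w) = w := Function.surjInv_eq hsurj
  have hτc : ContinuousOn τ {basePoint e e'}ᶜ :=
    (isClosedMap_smash e e').continuousOn_surjInv hsurj fun x y => smash_injOn
  set O := α ⁻¹' wedgeBall e e' r
  set C := α ⁻¹' wedgeClosedBall e e' r
  have hO : IsOpen O := (isOpen_wedgeBall e e' r).preimage hα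
  have hC : IsClosed C := (isClosed_wedgeClosedBall e e' r).preimage hα
  have hOC : O ⊆ C := preimage_mono (wedgeBall_subset_wedgeClosedBall e e' r)
  have hne : ∀ x ∉ O, α x ≠ basePoint e e' := fun x hx h =>
    hx (show α x ∈ _ from h ▸ basePoint_mem_wedgeBall e e' hr)
  have hτα : ContinuousOn (fun x => τ (α x)) Oᶜ := hτc.comp hα.continuousOn hne
  have hβ₀τ : ∀ x ∈ sphere (0 : Fin m → ℝ) 1, x ∉ O → β₀ x = τ (α x) := by
    intro x hx hxO
    have h1 : smash e e' (β₀ x) = α x := (hR x hx).resolve_right fun h => hxO h.2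
    exact smash_injOn (h1.trans (hqτ _).symm) (h1 ▸ hne x hxO)
  set β₁ : (Fin m → ℝ) → ConnectedSum e e' :=
    fun x => if x ∈ sphere (0 : Fin m → ℝ) 1 then β₀ x else τ (α x) with hβ₁
  have hβ₁s : EqOn β₁ β₀ (sphere 0 1) := fun x hx => if_pos hx
  have hβ₁τ : EqOn β₁ (fun x => τ (α x)) Oᶜ := by
    intro x hx
    by_cases hxs : x ∈ sphere (0 : Fin m → ℝ) 1
    · exact (if_pos hxs).trans (hβ₀τ x hxs hx)
    · exact if_neg hxs
  -- Both pieces are closed and agree where they meet, since outside `O` the boundary lift is exact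
  -- and so equals `τ ∘ α`.
  have hβ₁c : ContinuousOn β₁ (sphere 0 1 ∪ Oᶜ) :=
    (hβ₀.congr hβ₁s).union_of_isClosed (hτα.congr hβ₁τ) isClosed_sphere hO.isClosed_compl
  set F := (sphere 0 1 ∪ Oᶜ) ∩ C
  have hF : IsClosed F := (isClosed_sphere.union hO.isClosed_compl).inter hC
  have hβ₁C : ∀ x ∈ F, smash e e' (β₁ x) ∈ wedgeClosedBall e e' r := by
    rintro x ⟨hx | hx, hxC⟩
    · rw [hβ₁s hx]
      rcases hR x hx with h | h
      · rw [h]; exact hxC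
      · exact wedgeBall_subset_wedgeClosedBall e e' r h.1
    · rw [hβ₁τ hx, hqτ]
      exact hxC
  have hnorm : ∀ x ∈ F, ‖neckCoord e e' (β₁ x)‖ ∈ Icc (1 + r / 2)⁻¹ (1 + r / 2) := by
    intro x hx
    obtain ⟨v, hv⟩ := exists_neck_eq e e' (hβ₁C x hx)
    rw [← hv, neckCoord_neck, ← smash_neck_mem_iff e e' hr hr2, hv]
    exact hβ₁C x hx
  have ha : 0 < (1 + r / 2)⁻¹ := by positivity
  obtain ⟨g, hg, hgF, hgn⟩ := exists_extension_annulus (E := Fin m → ℝ)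
    (F := EuclideanSpace ℝ (Fin n)) (by simpa using hm) ha
    ((inv_le_one_of_one_le₀ (by linarith)).trans (by linarith : (1 : ℝ) ≤ 1 + r / 2)) hF
    ((continuousOn_neckCoord e e' hr hr2).comp (hβ₁c.mono inter_subset_left) hβ₁C) hnorm
  have hg0 : ∀ x, g x ≠ 0 := fun x => norm_ne_zero_iff.1 (ha.trans_le (hgn x).1).ne'
  set β₂ : (Fin m → ℝ) → ConnectedSum e e' := fun x => neck e e' ⟨g x, hg0 x⟩ with hβ₂
  have hβ₂c : Continuous β₂ := (continuous_neck e e').comp (hg.subtype_mk _)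
  have hβ₂F : EqOn β₂ β₁ F := by
    intro x hx
    obtain ⟨v, hv⟩ := exists_neck_eq e e' (hβ₁C x hx)
    have h1 := hgF hx
    rw [Function.comp, ← hv, neckCoord_neck] at h1
    rw [← hv]
    exact congrArg (neck e e') (Subtype.ext h1)
  set β : (Fin m → ℝ) → ConnectedSum e e' := fun x => if x ∈ C then β₂ x else τ (α x) with hβ
  have hβC : EqOn β β₂ C := fun x hx => if_pos hx
  have hβO : EqOn β (fun x => τ (α x)) Oᶜ := by
    intro x hx
    by_cases hxC : x ∈ C
    · rw [hβC hxC, hβ₂F ⟨Or.inr hx, hxC⟩, hβ₁τ hx]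
    · exact if_neg hxC
  refine ⟨β, ?_, fun x hx => ?_, fun x _ => ?_⟩
  · refine ((hβ₂c.continuousOn.congr hβC).union_of_isClosed (hτα.congr hβO) hC
      hO.isClosed_compl).mono fun x _ => ?_
    by_cases hxO : x ∈ O
    exacts [Or.inl (hOC hxO), Or.inr hxO]
  · by_cases hxC : x ∈ C
    · rw [hβC hxC, hβ₂F ⟨Or.inl hx, hxC⟩, hβ₁s hx]
    · have hxO : x ∉ O := fun h => hxC (hOC h)
      rw [hβO hxO, hβ₀τ x hx hxO]
  · by_cases hxC : x ∈ C
    · right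
      rw [hβC hxC]
      exact ⟨(smash_neck_mem_iff e e' hr hr2 _).2 (hgn x), hxC⟩
    · left
      rw [hβO fun h => hxC (hOC h), hqτ]

end ConnectedSum

/-! ### Homotopies in a simply connected part, constant elsewhere -/

open scoped unitInterval

/-- The map of the square onto itself which collapses two opposite sides to two opposite corners and
maps each of the other two sides onto two adjacent sides. -/
def bigonCollapse : C(I × I, I × I) where
  toFun z :=
    (⟨z.2 + (2 * z.1 - 1) * min (z.2 : ℝ) (1 - z.2), by
      have h1 := z.1.2.1; have h2 := z.1.2.2; have h3 := z.2.2.1; have h4 := z.2.2.2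
      rcases min_cases (z.2 : ℝ) (1 - z.2 : ℝ) with h | h <;> rw [h.1] <;>
        constructor <;> nlinarith⟩,
     ⟨z.2 - (2 * z.1 - 1) * min (z.2 : ℝ) (1 - z.2), by
      have h1 := z.1.2.1; have h2 := z.1.2.2; have h3 := z.2.2.1; have h4 := z.2.2.2
      rcases min_cases (z.2 : ℝ) (1 - z.2 : ℝ) with h | h <;> rw [h.1] <;>
        constructor <;> nlinarith⟩)
  continuous_toFun := by fun_prop

theorem bigonCollapse_eq_iff {z : I × I} {x y : I} : bigonCollapse z = (x, y) ↔
    (z.2 + (2 * z.1 - 1) * min (z.2 : ℝ) (1 - z.2) = (x : ℝ)) ∧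
      (z.2 - (2 * z.1 - 1) * min (z.2 : ℝ) (1 - z.2) = (y : ℝ)) := by
  rw [Prod.ext_iff, Subtype.ext_iff, Subtype.ext_iff]
  rfl

theorem bigonCollapse_surjective : Function.Surjective bigonCollapse := by
  rintro ⟨x, y⟩
  have hx1 := x.2.1; have hx2 := x.2.2; have hy1 := y.2.1; have hy2 := y.2.2
  set c : ℝ := min ((x + y) / 2 : ℝ) (1 - (x + y) / 2 : ℝ) with hc
  have hxy : |(x - y : ℝ)| ≤ 2 * c := by
    rw [abs_le, hc]
    rcases min_cases ((x + y) / 2 : ℝ) (1 - (x + y) / 2 : ℝ) with h | h <;> rw [h.1] <;>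
      constructor <;> linarith
  rcases eq_or_ne c 0 with h0 | h0
  · refine ⟨(0, ⟨(x + y) / 2, by linarith, by linarith⟩), bigonCollapse_eq_iff.2 ?_⟩
    rw [h0, mul_zero, abs_nonpos_iff] at hxy
    simp only [← hc, h0]
    constructor <;> linarith
  · have hc0 : 0 < c := lt_of_le_of_ne (by linarith [abs_nonneg (x - y : ℝ)]) h0.symm
    rw [abs_le] at hxy
    refine ⟨(⟨((x - y) / (2 * c) + 1) / 2, ?_, ?_⟩, ⟨(x + y) / 2, by linarith, by linarith⟩),
      bigonCollapse_eq_iff.2 ?_⟩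
    · have : -1 ≤ (x - y : ℝ) / (2 * c) := by rw [le_div_iff₀ (by positivity)]; linarith
      linarith
    · have : (x - y : ℝ) / (2 * c) ≤ 1 := by rw [div_le_iff₀ (by positivity)]; linarith
      linarith
    · simp only [← hc]
      have : (2 * (((x - y) / (2 * c) + 1) / 2) - 1) * c = (x - y : ℝ) / 2 := by
        field_simp
        ring
      rw [this]
      constructor <;> ring

/-- In a simply connected space each closed curve given on the boundary of the square extends over
the square. -/
theorem exists_square_filling {Y : Type*} [TopologicalSpace Y] [SimplyConnectedSpace Y]
    {a b c d : Y} (left : Path a c) (right : Path b d) (bot : Path a b) (top : Path c d) :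
    ∃ F : C(I × I, Y), (∀ s, F (0, s) = left s) ∧ (∀ s, F (1, s) = right s) ∧
      (∀ x, F (x, 0) = bot x) ∧ ∀ x, F (x, 1) = top x := by
  -- The two ways around the square are homotopic relative to their endpoints. The homotopy is
  -- constant on the two sides that `bigonCollapse` collapses, so it descends to the square.
  obtain ⟨K⟩ := SimplyConnectedSpace.paths_homotopic (left.trans top) (bot.trans right)
  have hq : IsQuotientMap bigonCollapse :=
    (bigonCollapse.continuous.isClosedMap).isQuotientMap bigonCollapse.continuous
      bigonCollapse_surjective
  have hfac : Function.FactorsThrough K.toContinuousMap bigonCollapse := by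
    rintro ⟨t, u⟩ ⟨t', u'⟩ h
    obtain ⟨h1, h2⟩ := bigonCollapse_eq_iff.1 h
    obtain rfl : u = u' := Subtype.ext (by linarith)
    have h3 : ((t : ℝ) - t') * min (u : ℝ) (1 - u) = 0 := by linarith
    rcases mul_eq_zero.1 h3 with h3 | h3
    · obtain rfl : t = t' := Subtype.ext (by linarith)
      rfl
    · rcases min_choice (u : ℝ) (1 - u) with h4 | h4 <;> rw [h4] at h3
      · obtain rfl : u = 0 := Subtype.ext h3
        exact (K.source t).trans (K.source t').symm
      · obtain rfl : u = 1 := Subtype.ext (by rw [Icc.coe_one]; linarith)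
        exact (K.target t).trans (K.target t').symm
  have hF : ∀ z, hq.lift K.toContinuousMap hfac (bigonCollapse z) = K z := fun z =>
    DFunLike.congr_fun (hq.lift_comp K.toContinuousMap hfac) z
  refine ⟨hq.lift K.toContinuousMap hfac, fun s => ?_, fun s => ?_, fun s => ?_, fun s => ?_⟩
  · have h1 := s.2.1; have h2 := s.2.2
    have : bigonCollapse (0, ⟨s / 2, by linarith, by linarith⟩) = (0, s) := by
      rw [bigonCollapse_eq_iff]
      simp only [Icc.coe_zero]
      rw [min_eq_left (by linarith)]
      constructor <;> ring
    rw [← this, hF, K.apply_zero]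
    refine (Path.trans_apply left top _).trans ?_
    rw [dif_pos (show (s : ℝ) / 2 ≤ 1 / 2 by linarith)]
    exact congrArg left (Subtype.ext (by simp only; ring))
  · have h1 := s.2.1; have h2 := s.2.2
    have : bigonCollapse (1, ⟨(s + 1) / 2, by linarith, by linarith⟩) = (1, s) := by
      rw [bigonCollapse_eq_iff]
      simp only [Icc.coe_one]
      rw [min_eq_right (by linarith)]
      constructor <;> ring
    rw [← this, hF, K.apply_one]
    refine (Path.trans_apply bot right _).trans ?_
    split_ifs with h
    · have hs : (s : ℝ) = 0 := by simp only at h; linarith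
      obtain rfl : s = 0 := Subtype.ext hs
      simp
    · exact congrArg right (Subtype.ext (by simp only; ring))
  · have h1 := s.2.1; have h2 := s.2.2
    have : bigonCollapse (1, ⟨s / 2, by linarith, by linarith⟩) = (s, 0) := by
      rw [bigonCollapse_eq_iff]
      simp only [Icc.coe_one, Icc.coe_zero]
      rw [min_eq_left (by linarith)]
      constructor <;> ring
    rw [← this, hF, K.apply_one]
    refine (Path.trans_apply bot right _).trans ?_
    rw [dif_pos (show (s : ℝ) / 2 ≤ 1 / 2 by linarith)]
    exact congrArg bot (Subtype.ext (by simp only; ring))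
  · have h1 := s.2.1; have h2 := s.2.2
    have : bigonCollapse (0, ⟨(s + 1) / 2, by linarith, by linarith⟩) = (s, 1) := by
      rw [bigonCollapse_eq_iff]
      simp only [Icc.coe_one, Icc.coe_zero]
      rw [min_eq_right (by linarith)]
      constructor <;> ring
    rw [← this, hF, K.apply_zero]
    refine (Path.trans_apply left top _).trans ?_
    split_ifs with h
    · have hs : (s : ℝ) = 0 := by simp only at h; linarith
      obtain rfl : s = 0 := Subtype.ext hs
      simp
    · exact congrArg top (Subtype.ext (by simp only; ring))

/-- `q` is a path from `f₀ x` to `f₁ x` which runs in `Y` if `x ∈ O` and which is constant if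
`x ∉ C`. -/
structure IsTrack {A T : Type*} [TopologicalSpace T] (f₀ f₁ : A → T) (Y : Set T) (O C : Set A)
    (x : A) (q : C(I, T)) : Prop where
  zero : q 0 = f₀ x
  one : q 1 = f₁ x
  mem : x ∈ O → ∀ s, q s ∈ Y
  const : x ∉ C → ∀ s, q s = f₀ x

section Track

variable {A T : Type*} [TopologicalSpace T] {f₀ f₁ : A → T} {Y : Set T} {O C : Set A}

/-- Tracks chosen at single points are constant off `C`; families produced by filling squares are
constant only off the larger `O`. -/
theorem IsTrack.weaken (hCO : C ⊆ O) {x : A} {q : C(I, T)} (h : IsTrack f₀ f₁ Y O C x q) :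
    IsTrack f₀ f₁ Y O O x q :=
  ⟨h.zero, h.one, h.mem, fun hx => h.const fun hc => hx (hCO hc)⟩

theorem exists_isTrack [PathConnectedSpace Y] (hCO : C ⊆ O) {x : A} (hC : x ∉ C → f₀ x = f₁ x)
    (hO : x ∈ O → f₀ x ∈ Y ∧ f₁ x ∈ Y) : ∃ q, IsTrack f₀ f₁ Y O C x q := by
  by_cases hx : x ∈ C
  · obtain ⟨h0, h1⟩ := hO (hCO hx)
    let q := PathConnectedSpace.somePath (⟨f₀ x, h0⟩ : Y) ⟨f₁ x, h1⟩
    exact ⟨⟨fun s => (q s).1, by fun_prop⟩, by simp, by simp, fun _ s => (q s).2,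
      fun h => absurd hx h⟩
  · exact ⟨ContinuousMap.const _ (f₀ x), rfl, hC hx, fun h _ => (hO h).1, fun _ _ => rfl⟩

end Track

section Interval

variable {T : Type*} [TopologicalSpace T] {f₀ f₁ : ℝ → T} {Y : Set T} {O C : Set ℝ}

/-- On an interval in `O`, the two end tracks, `f₀` and `f₁` bound a square in `Y`, which is filled.
On an interval missing `C`, the constant tracks serve. -/
theorem exists_track_of_subset [SimplyConnectedSpace Y] (hf₀ : Continuous f₀) (hf₁ : Continuous f₁)
    (hC : ∀ x ∉ C, f₀ x = f₁ x) (hO : ∀ x ∈ O, f₀ x ∈ Y ∧ f₁ x ∈ Y) {a b : ℝ} (hab : a < b)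
    (hsub : Icc a b ⊆ O ∨ Icc a b ⊆ Cᶜ) {qa qb : C(I, T)} (ha : IsTrack f₀ f₁ Y O C a qa)
    (hb : IsTrack f₀ f₁ Y O C b qb) :
    ∃ h : ℝ → C(I, T), ContinuousOn h (Icc a b) ∧ h a = qa ∧ h b = qb ∧
      ∀ x ∈ Icc a b, IsTrack f₀ f₁ Y O O x (h x) := by
  rcases hsub with hsub | hsub
  · let l : I → Icc a b := fun t => ⟨a + t * (b - a), by nlinarith [t.2.1], by nlinarith [t.2.2]⟩
    have hl : Continuous fun t => (l t : ℝ) := by fun_prop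
    have hl0 : (l 0 : ℝ) = a := by simp [l]
    have hl1 : (l 1 : ℝ) = b := by simp [l]
    have haO := hsub (left_mem_Icc.2 hab.le)
    have hbO := hsub (right_mem_Icc.2 hab.le)
    let left : Path (⟨f₀ a, (hO a haO).1⟩ : Y) ⟨f₁ a, (hO a haO).2⟩ :=
      { toFun := fun s => ⟨qa s, ha.mem haO s⟩
        continuous_toFun := by fun_prop
        source' := Subtype.ext ha.zero
        target' := Subtype.ext ha.one }
    let right : Path (⟨f₀ b, (hO b hbO).1⟩ : Y) ⟨f₁ b, (hO b hbO).2⟩ :=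
      { toFun := fun s => ⟨qb s, hb.mem hbO s⟩
        continuous_toFun := by fun_prop
        source' := Subtype.ext hb.zero
        target' := Subtype.ext hb.one }
    let bot : Path (⟨f₀ a, (hO a haO).1⟩ : Y) ⟨f₀ b, (hO b hbO).1⟩ :=
      { toFun := fun t => ⟨f₀ (l t), (hO _ (hsub (l t).2)).1⟩
        continuous_toFun := (hf₀.comp hl).subtype_mk _
        source' := Subtype.ext (congrArg f₀ hl0)
        target' := Subtype.ext (congrArg f₀ hl1) }
    let top : Path (⟨f₁ a, (hO a haO).2⟩ : Y) ⟨f₁ b, (hO b hbO).2⟩ :=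
      { toFun := fun t => ⟨f₁ (l t), (hO _ (hsub (l t).2)).2⟩
        continuous_toFun := (hf₁.comp hl).subtype_mk _
        source' := Subtype.ext (congrArg f₁ hl0)
        target' := Subtype.ext (congrArg f₁ hl1) }
    obtain ⟨F, hF0, hF1, hFb, hFt⟩ := exists_square_filling left right bot top
    let F' : C(I × I, T) := ⟨fun z => (F z).1, by fun_prop⟩
    let ρ : ℝ → I := fun x => projIcc 0 1 zero_le_one ((x - a) / (b - a))
    have hρ : Continuous ρ := continuous_projIcc.comp (by fun_prop)
    have hlρ : ∀ x ∈ Icc a b, (l (ρ x) : ℝ) = x := by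
      intro x hx
      have h1 : (x - a) / (b - a) ∈ Icc (0 : ℝ) 1 :=
        ⟨div_nonneg (by linarith [hx.1]) (by linarith),
          (div_le_one (by linarith)).2 (by linarith [hx.2])⟩
      have h2 : ((ρ x : I) : ℝ) = (x - a) / (b - a) := by
        simp only [ρ, projIcc_of_mem zero_le_one h1]
      have h3 : b - a ≠ 0 := by linarith
      simp only [l, h2]
      field_simp
      ring
    have hρa : ρ a = 0 := by simp [ρ]
    have hρb : ρ b = 1 := by
      have h3 : b - a ≠ 0 := by linarith
      simp [ρ, div_self h3]
    refine ⟨fun x => F'.curry (ρ x), (F'.curry.continuous.comp hρ).continuousOn, ?_, ?_,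
      fun x hx => ⟨?_, ?_, fun _ s => (F (ρ x, s)).2, fun h => absurd (hsub hx) h⟩⟩
    · ext s
      exact (congrArg (fun t => (F (t, s)).1) hρa).trans (congrArg Subtype.val (hF0 s))
    · ext s
      exact (congrArg (fun t => (F (t, s)).1) hρb).trans (congrArg Subtype.val (hF1 s))
    · exact (congrArg Subtype.val (hFb (ρ x))).trans (congrArg f₀ (hlρ x hx))
    · exact (congrArg Subtype.val (hFt (ρ x))).trans (congrArg f₁ (hlρ x hx))
  · refine ⟨fun x => ContinuousMap.const _ (f₀ x),
      (ContinuousMap.continuous_const'.comp hf₀).continuousOn, ?_, ?_, fun x hx =>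
        ⟨rfl, hC x (hsub hx), fun h _ => (hO x h).1, fun _ _ => rfl⟩⟩
    · ext s
      exact (ha.const (hsub (left_mem_Icc.2 hab.le)) s).symm
    · ext s
      exact (hb.const (hsub (right_mem_Icc.2 hab.le)) s).symm

/-- The open sets `O` and `Cᶜ` cover the interval; subdivide so that each piece lies in one of them.
Tracks at division points are constant off `C`, so pieces of either kind fit together. -/
theorem exists_track_Icc [SimplyConnectedSpace Y] (hf₀ : Continuous f₀) (hf₁ : Continuous f₁)
    (hCO : C ⊆ O) (hCc : IsClosed C) (hOo : IsOpen O)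
    (hC : ∀ x ∉ C, f₀ x = f₁ x) (hO : ∀ x ∈ O, f₀ x ∈ Y ∧ f₁ x ∈ Y) {a b : ℝ} (hab : a < b)
    {qa qb : C(I, T)} (ha : IsTrack f₀ f₁ Y O C a qa) (hb : IsTrack f₀ f₁ Y O C b qb) :
    ∃ h : ℝ → C(I, T), ContinuousOn h (Icc a b) ∧ h a = qa ∧ h b = qb ∧
      ∀ x ∈ Icc a b, IsTrack f₀ f₁ Y O O x (h x) := by
  obtain ⟨t, ht0, htm, ⟨N, hN⟩, htc⟩ := exists_monotone_Icc_subset_open_cover_Icc hab.le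
    (c := fun i : Bool => Subtype.val ⁻¹' (if i then O else Cᶜ))
    (fun i => by
      cases i
      · exact hCc.isOpen_compl.preimage continuous_subtype_val
      · exact hOo.preimage continuous_subtype_val)
    (fun x _ => by
      by_cases hx : (x : ℝ) ∈ O
      · exact mem_iUnion.2 ⟨true, hx⟩
      · exact mem_iUnion.2 ⟨false, fun h => hx (hCO h)⟩)
  -- The subdivision is only monotone and may repeat `a`, where the track is prescribed.
  have key : ∀ k, ∀ q, IsTrack f₀ f₁ Y O C (t k) q → ((t k : ℝ) = a → q = qa) →
      ∃ h : ℝ → C(I, T), ContinuousOn h (Icc a (t k)) ∧ h a = qa ∧ h (t k) = q ∧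
        ∀ x ∈ Icc a (t k : ℝ), IsTrack f₀ f₁ Y O O x (h x) := by
    intro k
    induction k with
    | zero =>
      intro q _ hqa
      refine ⟨fun _ => qa, continuousOn_const, rfl, (hqa ht0).symm, fun x hx => ?_⟩
      obtain rfl : x = a := le_antisymm (by rw [← ht0]; exact hx.2) hx.1
      exact ha.weaken hCO
    | succ k ih =>
      intro q hq hqa
      have hle : (t k : ℝ) ≤ t (k + 1) := htm k.le_succ
      rcases hle.eq_or_lt with heq | hlt
      · rw [← heq] at hq hqa ⊢
        exact ih q hq hqa
      obtain ⟨q', hq', hqa'⟩ : ∃ q', IsTrack f₀ f₁ Y O C (t k) q' ∧ ((t k : ℝ) = a → q' = qa) := by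
        by_cases h : (t k : ℝ) = a
        · exact ⟨qa, by rw [h]; exact ha, fun _ => rfl⟩
        · obtain ⟨q', hq'⟩ := exists_isTrack hCO (hC (t k)) (hO (t k))
          exact ⟨q', hq', fun h' => absurd h' h⟩
      obtain ⟨h1, h1c, h1a, h1t, h1track⟩ := ih q' hq' hqa'
      have hsub : Icc (t k : ℝ) (t (k + 1)) ⊆ O ∨ Icc (t k : ℝ) (t (k + 1)) ⊆ Cᶜ := by
        obtain ⟨i, hi⟩ := htc k
        have : Icc (t k : ℝ) (t (k + 1)) ⊆ if i then O else Cᶜ := by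
          intro x hx
          exact hi (a := ⟨x, (t k).2.1.trans hx.1, hx.2.trans (t (k + 1)).2.2⟩) ⟨hx.1, hx.2⟩
        cases i
        exacts [Or.inr this, Or.inl this]
      obtain ⟨h2, h2c, h2a, h2b, h2track⟩ :=
        exists_track_of_subset hf₀ hf₁ hC hO hlt hsub hq' hq
      have hak : a ≤ t k := (t k).2.1
      let h : ℝ → C(I, T) := fun x => if x ≤ t k then h1 x else h2 x
      have hh1 : EqOn h h1 (Icc a (t k)) := fun x hx => if_pos hx.2
      have hh2 : EqOn h h2 (Icc (t k) (t (k + 1))) := by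
        intro x hx
        rcases hx.1.eq_or_lt with h' | h'
        · rw [← h', h2a, ← h1t]
          exact if_pos le_rfl
        · exact if_neg (not_le.2 h')
      refine ⟨h, ?_, (hh1 (left_mem_Icc.2 hak)).trans h1a,
        (hh2 (right_mem_Icc.2 hle)).trans h2b, fun x hx => ?_⟩
      · rw [← Icc_union_Icc_eq_Icc hak hle]
        exact (h1c.congr hh1).union_of_isClosed (h2c.congr hh2) isClosed_Icc isClosed_Icc
      · rcases le_total x (t k) with hx' | hx'
        · rw [hh1 ⟨hx.1, hx'⟩]
          exact h1track x ⟨hx.1, hx'⟩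
        · rw [hh2 ⟨hx', hx.2⟩]
          exact h2track x ⟨hx', hx.2⟩
  have hNb := hN N le_rfl
  obtain ⟨h, h1, h2, h3, h4⟩ := key N qb (by rw [hNb]; exact hb) fun h => absurd (hNb.symm.trans h) hab.ne'
  rw [hNb] at h1 h3 h4
  exact ⟨h, h1, h2, h3, h4⟩

end Interval

section Sphere

open Real

/-- A homotopy between maps of the boundary of a cube of dimension at most two. -/
theorem exists_track_sphere {m : ℕ} (hm : m ≤ 2) {T : Type*} [TopologicalSpace T]
    {f₀ f₁ : (Fin m → ℝ) → T} {Y : Set T} {O C : Set (Fin m → ℝ)} [SimplyConnectedSpace Y]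
    (hf₀ : ContinuousOn f₀ (sphere 0 1)) (hf₁ : ContinuousOn f₁ (sphere 0 1))
    (hCO : C ⊆ O) (hCc : IsClosed C) (hOo : IsOpen O)
    (hC : ∀ x ∈ sphere (0 : Fin m → ℝ) 1, x ∉ C → f₀ x = f₁ x)
    (hO : ∀ x ∈ sphere (0 : Fin m → ℝ) 1, x ∈ O → f₀ x ∈ Y ∧ f₁ x ∈ Y) :
    ∃ h : (Fin m → ℝ) → C(I, T), ContinuousOn h (sphere 0 1) ∧
      ∀ x ∈ sphere (0 : Fin m → ℝ) 1, IsTrack f₀ f₁ Y O O x (h x) := by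
  classical
  have hT : Nonempty T := ⟨((PathConnectedSpace.nonempty : Nonempty Y).some : T)⟩
  rcases hm.lt_or_eq with hm | rfl
  -- For `m = 0` the sphere is empty and for `m = 1` it has two points, so continuity is automatic.
  · have hfin : (sphere (0 : Fin m → ℝ) 1).Finite := by
      have hsub : sphere (0 : Fin m → ℝ) 1 ⊆ {Function.const _ 1, Function.const _ (-1)} := by
        intro x hx
        have hx1 : ‖x‖ = 1 := mem_sphere_zero_iff_norm.1 hx
        interval_cases m
        · rw [Subsingleton.elim x 0, norm_zero] at hx1
          exact absurd hx1 zero_ne_one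
        · have h0 : x = Function.const _ (x 0) := by
            ext i
            rw [Subsingleton.elim i 0]; rfl
          rw [h0, show ‖Function.const (Fin 1) (x 0)‖ = ‖x 0‖ from pi_norm_const _,
            Real.norm_eq_abs] at hx1
          rcases (abs_eq zero_le_one).1 hx1 with h | h
          · left; rw [h0, h]
          · right; rw [h0, h]; rfl
      exact (toFinite _).subset hsub
    have hq : ∀ x : Fin m → ℝ, ∃ q : C(I, T), x ∈ sphere (0 : Fin m → ℝ) 1 →
        IsTrack f₀ f₁ Y O C x q := by
      intro x
      by_cases hx : x ∈ sphere (0 : Fin m → ℝ) 1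
      · obtain ⟨q, hq⟩ := exists_isTrack hCO (hC x hx) (hO x hx)
        exact ⟨q, fun _ => hq⟩
      · exact ⟨ContinuousMap.const _ (Classical.arbitrary T), fun h => absurd h hx⟩
    choose q hq using hq
    exact ⟨q, hfin.continuousOn q, fun x hx => (hq x hx).weaken hCO⟩
  · have hfact : Fact (0 < 2 * π) := ⟨two_pi_pos⟩
    let v : ℝ → Fin 2 → ℝ := fun t => ![cos t, sin t]
    have hv : Continuous v := by
      refine continuous_pi fun i => ?_
      fin_cases i
      exacts [continuous_cos, continuous_sin]
    have hv0 : ∀ t, ‖v t‖ ≠ 0 := by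
      intro t h
      rw [norm_eq_zero] at h
      have h0 : cos t = 0 := congrFun h 0
      have h1 : sin t = 0 := congrFun h 1
      have := sin_sq_add_cos_sq t
      rw [h0, h1] at this
      norm_num at this
    -- The unit sphere is that of the sup norm, the boundary of a square; the usual circle is
    -- rescaled onto it, and `θ` below recovers the angle.
    let γ : ℝ → Fin 2 → ℝ := fun t => ‖v t‖⁻¹ • v t
    have hγ : Continuous γ := (hv.norm.inv₀ hv0).smul hv
    have hγs : ∀ t, γ t ∈ sphere (0 : Fin 2 → ℝ) 1 := by
      intro t
      rw [mem_sphere_zero_iff_norm, norm_smul, norm_inv, norm_norm, inv_mul_cancel₀ (hv0 t)]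
    have hγp : γ (2 * π) = γ 0 := by simp [γ, v]
    let z : (Fin 2 → ℝ) → ℂ := fun x => ⟨x 0, x 1⟩
    have hz : Continuous z := by
      have : z = fun x => (x 0 : ℂ) + x 1 * Complex.I := by
        funext x
        exact Complex.mk_eq_add_mul_I _ _
      rw [this]
      fun_prop
    have hz0 : ∀ x : sphere (0 : Fin 2 → ℝ) 1, ‖z x‖ ≠ 0 := by
      intro x h
      rw [norm_eq_zero] at h
      have h0 : x.1 = 0 := by
        ext i
        fin_cases i
        exacts [congrArg Complex.re h, congrArg Complex.im h]
      have := mem_sphere_zero_iff_norm.1 x.2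
      rw [h0, norm_zero] at this
      exact zero_ne_one this
    let c : sphere (0 : Fin 2 → ℝ) 1 → Circle := fun x => ⟨(‖z x‖⁻¹ : ℝ) • z x, by
      change (‖z x‖⁻¹ : ℝ) • z x ∈ sphere (0 : ℂ) 1
      rw [mem_sphere_zero_iff_norm, norm_smul, norm_inv, norm_norm, inv_mul_cancel₀ (hz0 x)]⟩
    have hc : Continuous c := by
      refine Continuous.subtype_mk ?_ _
      exact (((hz.comp continuous_subtype_val).norm).inv₀ hz0).smul (hz.comp continuous_subtype_val)
    let θ : sphere (0 : Fin 2 → ℝ) 1 → AddCircle (2 * π) := fun x =>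
      AddCircle.homeomorphCircle'.symm (c x)
    have hθ : Continuous θ := AddCircle.homeomorphCircle'.symm.continuous.comp hc
    have hθγ : ∀ (x : sphere (0 : Fin 2 → ℝ) 1) (t : ℝ), θ x = t → γ t = x := by
      intro x t h
      have h1 : c x = Circle.exp t := by
        rw [← AddCircle.homeomorphCircle'_apply_mk, ← h]
        exact (AddCircle.homeomorphCircle'.apply_symm_apply _).symm
      have h2 : (‖z x‖⁻¹ : ℝ) • z x = Complex.exp (t * Complex.I) := by
        rw [← Circle.coe_exp, ← h1]
      have h3 : ‖z x‖⁻¹ • x.1 = v t := by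
        ext i
        fin_cases i
        · have := congrArg Complex.re h2
          rw [Complex.smul_re, Complex.exp_ofReal_mul_I_re] at this
          exact this
        · have := congrArg Complex.im h2
          rw [Complex.smul_im, Complex.exp_ofReal_mul_I_im] at this
          exact this
      have h4 : ‖v t‖ = ‖z x‖⁻¹ := by
        rw [← h3, norm_smul, norm_inv, norm_norm, mem_sphere_zero_iff_norm.1 x.2, mul_one]
      simp only [γ]
      rw [h4, ← h3, inv_inv, smul_smul, mul_inv_cancel₀ (hz0 x), one_smul]
    -- The same track is used at `0` and `2 * π`, so the family closes up over the circle.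
    obtain ⟨q, hq⟩ := exists_isTrack (f₀ := f₀ ∘ γ) (f₁ := f₁ ∘ γ) (Y := Y) (O := γ ⁻¹' O)
      (C := γ ⁻¹' C) (preimage_mono hCO) (x := 0) (hC _ (hγs 0)) (hO _ (hγs 0))
    have hq' : IsTrack (f₀ ∘ γ) (f₁ ∘ γ) Y (γ ⁻¹' O) (γ ⁻¹' C) (2 * π) q := by
      obtain ⟨h1, h2, h3, h4⟩ := hq
      constructor
      · rw [h1, Function.comp, Function.comp, hγp]
      · rw [h2, Function.comp, Function.comp, hγp]
      · intro h
        exact h3 (by rwa [mem_preimage, ← hγp])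
      · intro h s
        rw [h4 (by rwa [mem_preimage, ← hγp]), Function.comp, Function.comp, hγp]
    obtain ⟨h, hh, hh0, hh1, htrack⟩ := exists_track_Icc (hf₀.comp_continuous hγ hγs)
      (hf₁.comp_continuous hγ hγs) (preimage_mono hCO) (hCc.preimage hγ) (hOo.preimage hγ)
      (fun t => hC _ (hγs t)) (fun t => hO _ (hγs t)) two_pi_pos hq hq'
    have hlift : Continuous (AddCircle.liftIco (2 * π) 0 h) :=
      AddCircle.liftIco_zero_continuous (hh0.trans hh1.symm) hh
    refine ⟨Function.extend Subtype.val (fun x => AddCircle.liftIco (2 * π) 0 h (θ x))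
      (fun _ => q), ?_, fun x hx => ?_⟩
    · rw [continuousOn_iff_continuous_domRestrict]
      refine (hlift.comp hθ).congr fun x => ?_
      exact (Subtype.val_injective.extend_apply _ _ x).symm
    · have hx' := Subtype.val_injective.extend_apply
        (fun x => AddCircle.liftIco (2 * π) 0 h (θ x)) (fun _ => q) (⟨x, hx⟩ : sphere _ _)
      simp only at hx'
      rw [hx']
      obtain ⟨t, ht, htx⟩ : θ ⟨x, hx⟩ ∈ QuotientAddGroup.mk '' Ico 0 (0 + 2 * π) := by
        rw [AddCircle.coe_image_Ico_eq]; trivial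
      rw [zero_add] at ht
      have hγt : γ t = x := hθγ ⟨x, hx⟩ t htx.symm
      rw [← htx]
      have h1 : AddCircle.liftIco (2 * π) 0 h (t : AddCircle (2 * π)) = h t :=
        AddCircle.liftIco_zero_coe_apply ht
      have h2 := htrack t (Ico_subset_Icc_self ht)
      refine h1 ▸ ?_
      obtain ⟨g1, g2, g3, g4⟩ := h2
      simp only [Function.comp, mem_preimage, hγt] at g1 g2 g3 g4
      exact ⟨g1, g2, g3, g4⟩

end Sphere

/-! ### Lifting from `M` to the wedge -/

theorem dist_clampBall_smul_le {E : Type*} [NormedAddCommGroup E] [NormedSpace ℝ E] {y : E}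
    (hy : ‖y‖ ≤ 1) {a : ℝ} (ha : 0 ≤ a) : dist (clampBall ((1 + a) • y)) y ≤ a := by
  have hn : ‖(1 + a) • y‖ = (1 + a) * ‖y‖ := by
    rw [norm_smul, Real.norm_of_nonneg (by linarith)]
  set d := max 1 ((1 + a) * ‖y‖) with hd
  have hd1 : 1 ≤ d := le_max_left _ _
  have hda : d ≤ 1 + a := max_le (by linarith) (mul_le_of_le_one_right (by linarith) hy)
  have hc : clampBall ((1 + a) • y) - y = ((1 + a) / d - 1) • y := by
    rw [clampBall, hn, ← hd, smul_smul, sub_smul, one_smul, div_eq_inv_mul]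
  have h1 : 1 ≤ (1 + a) / d := (one_le_div (by linarith)).2 hda
  have h2 : (1 + a) / d ≤ 1 + a := div_le_self (by linarith) hd1
  rw [dist_eq_norm, hc, norm_smul, Real.norm_of_nonneg (by linarith)]
  calc ((1 + a) / d - 1) * ‖y‖ ≤ ((1 + a) / d - 1) * 1 := by gcongr
    _ ≤ a := by linarith

theorem clampBall_smul_of_norm_eq_one {E : Type*} [NormedAddCommGroup E] [NormedSpace ℝ E] {y : E}
    (hy : ‖y‖ = 1) {a : ℝ} (ha : 0 ≤ a) : clampBall ((1 + a) • y) = y := by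
  have h : (1 + a) ≠ 0 := by linarith
  rw [clampBall, norm_smul, Real.norm_of_nonneg (by linarith), hy, mul_one,
    max_eq_right (by linarith), smul_smul, inv_mul_cancel₀ h, one_smul]

namespace ConnectedSum

open CoordBall

variable {n : ℕ} {M M' : Type*} [TopologicalSpace M] [TopologicalSpace M']
  (e : CoordBall n M) (e' : CoordBall n M')

/-- The part of the wedge lying over a coordinate ball in `M`. -/
def wedgeOverBall (r : ℝ) : Set (Wedge e.center e'.center) :=
  {w | w.1.1 ∈ e.emb '' ball 0 r}

variable {r : ℝ}

/-- The coordinates of the first component. -/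
def wedgeOverBallCoord (w : wedgeOverBall e e' r) : EuclideanSpace ℝ (Fin n) :=
  e.isOpenEmbedding.isEmbedding.toHomeomorph.symm ⟨w.1.1.1, image_subset_range _ _ w.2⟩

theorem emb_wedgeOverBallCoord (w : wedgeOverBall e e' r) :
    e.emb (wedgeOverBallCoord e e' w) = w.1.1.1 :=
  congrArg Subtype.val (e.isOpenEmbedding.isEmbedding.toHomeomorph.apply_symm_apply
    ⟨w.1.1.1, image_subset_range _ _ w.2⟩)

theorem norm_wedgeOverBallCoord (w : wedgeOverBall e e' r) :
    ‖wedgeOverBallCoord e e' w‖ < r := by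
  have h : e.emb (wedgeOverBallCoord e e' w) ∈ e.emb '' ball 0 r := by
    rw [emb_wedgeOverBallCoord]
    exact w.2
  rwa [emb_mem_image_iff, mem_ball_zero_iff] at h

theorem continuous_wedgeOverBallCoord :
    Continuous (wedgeOverBallCoord e e' : wedgeOverBall e e' r → _) :=
  e.isOpenEmbedding.isEmbedding.toHomeomorph.symm.continuous.comp
    ((continuous_fst.comp (continuous_subtype_val.comp continuous_subtype_val)).subtype_mk _)

/-- Radial contraction of the `M`-coordinate deforms this set onto the copy of `M'`. -/
theorem simplyConnectedSpace_wedgeOverBall [SimplyConnectedSpace M'] (hr : 0 < r) :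
    SimplyConnectedSpace (wedgeOverBall e e' r) := by
  let snd : C(wedgeOverBall e e' r, M') := ⟨fun w => w.1.1.2, by fun_prop⟩
  let inv : C(M', wedgeOverBall e e' r) :=
    ⟨fun y => ⟨⟨(e.center, y), Or.inl rfl⟩, e.center_mem_image_ball hr⟩, by fun_prop⟩
  let H : C(I × wedgeOverBall e e' r, wedgeOverBall e e' r) :=
    { toFun := fun z => ⟨⟨(e.emb ((z.1 : ℝ) • wedgeOverBallCoord e e' z.2), z.2.1.1.2), by
          rcases z.2.1.2 with h | h
          · left
            have h0 : wedgeOverBallCoord e e' z.2 = 0 :=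
              e.isOpenEmbedding.injective ((emb_wedgeOverBallCoord e e' z.2).trans h)
            rw [h0, smul_zero]; rfl
          · exact Or.inr h⟩, by
        refine ⟨_, ?_, rfl⟩
        rw [mem_ball_zero_iff, norm_smul, Real.norm_of_nonneg z.1.2.1]
        exact (mul_le_of_le_one_left (norm_nonneg _) z.1.2.2).trans_lt
          (norm_wedgeOverBallCoord e e' z.2)⟩
      continuous_toFun := by
        refine Continuous.subtype_mk (Continuous.subtype_mk (Continuous.prodMk ?_ ?_) _) _
        · exact e.isOpenEmbedding.continuous.comp ((continuous_subtype_val.comp continuous_fst).smul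
            ((continuous_wedgeOverBallCoord e e').comp continuous_snd))
        · fun_prop }
  have h : ContinuousMap.HomotopyEquiv (wedgeOverBall e e' r) M' :=
    { toFun := snd
      invFun := inv
      left_inv := ⟨{ toContinuousMap := H
                     map_zero_left := fun w => by
                      refine Subtype.ext (Subtype.ext (Prod.ext ?_ rfl))
                      change e.emb ((0 : ℝ) • _) = e.center
                      rw [zero_smul]; rfl
                     map_one_left := fun w => by
                      refine Subtype.ext (Subtype.ext (Prod.ext ?_ rfl))
                      change e.emb ((1 : ℝ) • _) = _
                      rw [one_smul, emb_wedgeOverBallCoord]; rfl }⟩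
      right_inv := by
        have : snd.comp inv = ContinuousMap.id M' := rfl
        rw [this] }
  exact h.simplyConnectedSpace

/-- The inclusion of `M` into the wedge. -/
def wedgeInl (x : M) : Wedge e.center e'.center := ⟨(x, e'.center), Or.inr rfl⟩

theorem continuous_wedgeInl : Continuous (wedgeInl e e') := by
  unfold wedgeInl
  fun_prop

/-- Inside the cube the lift is `wedgeInl ∘ α`, slightly reparametrized; in a collar it follows
tracks from this section to `β₀`. With `r < r₁ < r₂ < r'`, nonconstant tracks occur only over radius
`r₁`, and the collar has positive width only over radius `r₂`. -/
theorem cellExtension_fst [T2Space M] [SimplyConnectedSpace M'] {m : ℕ} (hm : m ≤ 2) {r r' : ℝ}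
    (hr : 0 < r) (hrr' : r < r') :
    CellExtension m
      (fun (w : Wedge e.center e'.center) b => w.1.1 = b ∨
        w.1.1 ∈ e.emb '' ball 0 r ∧ b ∈ e.emb '' ball 0 r)
      (fun (w : Wedge e.center e'.center) b => w.1.1 = b ∨
        w.1.1 ∈ e.emb '' ball 0 r' ∧ b ∈ e.emb '' ball 0 r') := by
  classical
  intro α hα β₀ hβ₀ hR
  obtain ⟨r₁, hr₁, hr₁'⟩ := exists_between hrr'
  obtain ⟨r₂, hr₂, hr₂'⟩ := exists_between hr₁'
  have := simplyConnectedSpace_wedgeOverBall e e' (hr.trans hr₁)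
  have hσ : Continuous fun x => wedgeInl e e' (α x) := (continuous_wedgeInl e e').comp hα
  have hballs : ∀ {s t : ℝ}, s < t → e.emb '' closedBall 0 s ⊆ e.emb '' ball 0 t :=
    fun h => image_mono (closedBall_subset_ball h)
  have hcb : ∀ {s : ℝ}, e.emb '' ball 0 s ⊆ e.emb '' closedBall 0 s := by
    intro s
    exact image_mono ball_subset_closedBall
  set O : Set (Fin m → ℝ) := α ⁻¹' (e.emb '' ball 0 r₁) with hOdef
  obtain ⟨h, hh, htrack⟩ := exists_track_sphere hm (f₀ := fun x => wedgeInl e e' (α x)) (f₁ := β₀)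
    (Y := wedgeOverBall e e' r₁) (O := O) (C := α ⁻¹' (e.emb '' closedBall 0 r))
    hσ.continuousOn hβ₀ (preimage_mono (hballs hr₁))
    ((e.isClosed_image_closedBall r).preimage hα) ((e.isOpen_image_ball r₁).preimage hα)
    (fun x hx hxC => by
      have h1 : (β₀ x).1.1 = α x := (hR x hx).resolve_right fun h => hxC (hcb h.2)
      have h2 : (β₀ x).1.1 ≠ e.center := fun hc =>
        hxC (by
          rw [mem_preimage, ← h1, hc]
          exact hcb (e.center_mem_image_ball hr))
      exact Subtype.ext (Prod.ext h1.symm ((β₀ x).2.resolve_left h2).symm))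
    (fun x hx hxO => ⟨hxO, by
      rcases hR x hx with h1 | h1
      · change (β₀ x).1.1 ∈ e.emb '' ball 0 r₁
        rw [h1]
        exact hxO
      · exact e.image_ball_subset hr₁.le h1.1⟩)
  -- `η` bounds the displacement by `κ`, so that points over radius `r₂` stay over radius `r'`.
  obtain ⟨η, hη, hηsub⟩ := ((isCompact_closedBall (0 : Fin m → ℝ) 1).inter_right
    ((e.isClosed_image_closedBall r₂).preimage hα)).exists_cthickening_subset_open
    ((e.isOpen_image_ball r').preimage hα) (fun x hx => hballs hr₂' hx.2)
  obtain ⟨u, hu0, hu1, hu⟩ := exists_continuous_zero_one_of_isClosed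
    (((e.isOpen_image_ball r₂).preimage hα).isClosed_compl)
    ((e.isClosed_image_closedBall r₁).preimage hα)
    (disjoint_left.2 fun x hx hx' => hx (hballs hr₂ hx'))
  set a : (Fin m → ℝ) → ℝ := fun y => η * u y with ha
  have hac : Continuous a := by fun_prop
  have ha0 : ∀ y, 0 ≤ a y := fun y => mul_nonneg hη.le (hu y).1
  have haη : ∀ y, a y ≤ η := fun y => mul_le_of_le_one_right hη.le (hu y).2
  set z : (Fin m → ℝ) → (Fin m → ℝ) := fun y => (1 + a y) • y with hz
  have hzc : Continuous z := by fun_prop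
  set κ : (Fin m → ℝ) → (Fin m → ℝ) := fun y => clampBall (z y) with hκ
  have hκc : Continuous κ := continuous_clampBall.comp hzc
  set s : (Fin m → ℝ) → I := fun y => projIcc 0 1 zero_le_one ((‖z y‖ - 1) / η) with hs
  have hsc : Continuous s := continuous_projIcc.comp (by fun_prop)
  set P : Set (Fin m → ℝ) := {y | ‖z y‖ ≤ 1}
  set Q : Set (Fin m → ℝ) := {y | 1 ≤ ‖z y‖}
  have hκQ : ∀ y ∈ Q, κ y ∈ sphere (0 : Fin m → ℝ) 1 := fun y hy => by
    rw [mem_sphere_zero_iff_norm, hκ, norm_clampBall, min_eq_left hy]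
  set β : (Fin m → ℝ) → Wedge e.center e'.center :=
    fun y => if y ∈ P then wedgeInl e e' (α (κ y)) else h (κ y) (s y)
  have hβP : EqOn β (fun y => wedgeInl e e' (α (κ y))) P := fun y hy => if_pos hy
  have hβQ : EqOn β (fun y => h (κ y) (s y)) Q := by
    intro y hy
    by_cases hyP : y ∈ P
    · have h1 : ‖z y‖ = 1 := le_antisymm hyP hy
      have h2 : s y = 0 := by simp [hs, h1]
      rw [hβP hyP]
      simp only [h2]
      exact (htrack _ (hκQ y hy)).zero.symm
    · exact if_neg hyP
  refine ⟨β, ?_, fun x hx => ?_, fun y hy => ?_⟩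
  · have h1 : ContinuousOn β P := (hσ.comp hκc).continuousOn.congr hβP
    have h2 : ContinuousOn β Q := by
      refine ContinuousOn.congr ?_ hβQ
      exact continuous_eval.comp_continuousOn
        ((hh.comp hκc.continuousOn hκQ).prodMk hsc.continuousOn)
    exact (h1.union_of_isClosed h2 (isClosed_le hzc.norm continuous_const)
      (isClosed_le continuous_const hzc.norm)).mono fun y _ => le_total ‖z y‖ 1
  · have hx1 : ‖x‖ = 1 := mem_sphere_zero_iff_norm.1 hx
    have hzx : ‖z x‖ = 1 + a x := by
      rw [hz, norm_smul, hx1, mul_one, Real.norm_of_nonneg (by linarith [ha0 x])]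
    have hκx : κ x = x := clampBall_smul_of_norm_eq_one hx1 (ha0 x)
    have hxQ : x ∈ Q := by
      change 1 ≤ ‖z x‖
      linarith [ha0 x]
    rw [hβQ hxQ]
    simp only [hκx]
    -- The track time at a boundary point is `u x`. It is 1 over `O`; elsewhere it may be less, but
    -- there the track is constant.
    by_cases hxO : x ∈ O
    · have hux : u x = 1 := hu1 (hcb hxO)
      have hsx : s x = 1 := by
        simp only [hs, hzx, ha, hux, mul_one, add_sub_cancel_left, div_self hη.ne']
        simp
      rw [hsx]
      exact (htrack x hx).one
    · rw [(htrack x hx).const hxO, ← (htrack x hx).const hxO 1]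
      exact (htrack x hx).one
  · have hy1 : ‖y‖ ≤ 1 := mem_closedBall_zero_iff.1 hy
    by_cases hyr : α y ∈ e.emb '' ball 0 r₂
    · right
      refine ⟨?_, e.image_ball_subset hr₂'.le hyr⟩
      have hακ : α (κ y) ∈ e.emb '' ball 0 r' := by
        refine hηsub (mem_cthickening_of_dist_le (κ y) y η _ ⟨hy, hcb hyr⟩ ?_)
        exact (dist_clampBall_smul_le hy1 (ha0 y)).trans (haη y)
      by_cases hyP : y ∈ P
      · rw [hβP hyP]
        exact hακ
      · have hyQ : y ∈ Q := (le_total ‖z y‖ 1).resolve_left hyP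
        rw [hβQ hyQ]
        by_cases hyO : κ y ∈ O
        · exact e.image_ball_subset hr₁'.le ((htrack _ (hκQ y hyQ)).mem hyO (s y))
        · simp only [(htrack _ (hκQ y hyQ)).const hyO]
          exact hακ
    · left
      have hay : a y = 0 := by
        have : u y = 0 := hu0 hyr
        simp [ha, this]
      have hzy : z y = y := by simp [hz, hay]
      have hyP : y ∈ P := by
        change ‖z y‖ ≤ 1
        rwa [hzy]
      rw [hβP hyP]
      change α (clampBall (z y)) = α y
      rw [hzy, clampBall_of_norm_le hy1]

end ConnectedSum

/-! ### From small balls to small distances -/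

theorem CellExtension.mono {T B : Type*} [TopologicalSpace T] [TopologicalSpace B] {m : ℕ}
    {R R' R'' : T → B → Prop} (h : CellExtension m R R') (h' : ∀ w b, R' w b → R'' w b) :
    CellExtension m R R'' := fun α hα β₀ hβ₀ hR =>
  let ⟨β, h1, h2, h3⟩ := h α hα β₀ hβ₀ hR
  ⟨β, h1, h2, fun x hx => h' _ _ (h3 x hx)⟩

theorem exists_mem_nhds_forall_dist_lt {B : Type*} [tB : TopologicalSpace B] (d : MetricSpace B)
    (hd : d.toUniformSpace.toTopologicalSpace = tB) (c : B) {δ : ℝ} (hδ : 0 < δ) :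
    ∃ U ∈ 𝓝 c, ∀ x ∈ U, ∀ y ∈ U, d.dist x y < δ := by
  subst hd
  refine ⟨ball c (δ / 2), ball_mem_nhds c (half_pos hδ), fun x hx y hy => ?_⟩
  have := dist_triangle_right x y c
  rw [mem_ball] at hx hy
  exact this.trans_lt (by linarith)

theorem CoordBall.exists_image_ball_subset {n : ℕ} {M : Type*} [TopologicalSpace M]
    (e : CoordBall n M) {U : Set M} (hU : U ∈ 𝓝 e.center) :
    ∃ r, 0 < r ∧ r ≤ 2 ∧ e.emb '' ball 0 r ⊆ U := by
  obtain ⟨r, hr, hrU⟩ := Metric.mem_nhds_iff.1 (e.isOpenEmbedding.continuous.continuousAt hU)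
  exact ⟨min r 2, lt_min hr two_pos, min_le_right _ _,
    image_subset_iff.2 ((ball_subset_ball (min_le_left _ _)).trans hrU)⟩

theorem metrizableSpace_of_chartedSpace (n : ℕ) (M : Type*) [TopologicalSpace M] [T2Space M]
    [SecondCountableTopology M] [ChartedSpace (EuclideanSpace ℝ (Fin n)) M] :
    TopologicalSpace.MetrizableSpace M := by
  have := ChartedSpace.locallyCompactSpace (EuclideanSpace ℝ (Fin n)) M
  infer_instance

namespace ConnectedSum

variable {n : ℕ} {M : Type u} {M' : Type v} [TopologicalSpace M] [TopologicalSpace M']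
  (e : CoordBall n M) (e' : CoordBall n M')
  {K : Type w} [TopologicalSpace K] [T2Space K] [CWComplex (univ : Set K)]

theorem exists_wedgeBall_subset {U : Set (Wedge e.center e'.center)}
    (hU : U ∈ 𝓝 (basePoint e e')) : ∃ r, 0 < r ∧ r ≤ 2 ∧ wedgeBall e e' r ⊆ U := by
  rw [basePoint, nhds_subtype_eq_comap, nhds_prod_eq, Filter.mem_comap] at hU
  obtain ⟨V, hV, hVU⟩ := hU
  obtain ⟨V₁, hV₁, V₂, hV₂, hV₁₂⟩ := Filter.mem_prod_iff.1 hV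
  obtain ⟨r₁, h1, h1', h1s⟩ := e.exists_image_ball_subset hV₁
  obtain ⟨r₂, h2, -, h2s⟩ := e'.exists_image_ball_subset hV₂
  refine ⟨min r₁ r₂, lt_min h1 h2, (min_le_left _ _).trans h1', fun w hw => hVU (hV₁₂ ⟨?_, ?_⟩)⟩
  · exact h1s (e.image_ball_subset (min_le_left _ _) hw.1)
  · exact h2s (e'.image_ball_subset (min_le_right _ _) hw.2)

/-- Maps of 2-complexes to the wedge lift to the connected sum, up to an error near the base
point. -/
theorem exists_lift_smash [T2Space M] [T2Space M'] (hn : 3 ≤ n) (hK : IsTwoComplex K)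
    (K₀ : RelCWComplex.Subcomplex (univ : Set K)) (α₀ : C(K₀, ConnectedSum e e'))
    (α : C(K, Wedge e.center e'.center)) (h : ∀ u : K₀, smash e e' (α₀ u) = α u) {r : ℝ}
    (hr : 0 < r) (hr2 : r ≤ 2) :
    ∃ α' : C(K, ConnectedSum e e'), (∀ u : K₀, α' u = α₀ u) ∧ ∀ u, smash e e' (α' u) = α u ∨
      smash e e' (α' u) ∈ wedgeBall e e' r ∧ α u ∈ wedgeBall e e' r := by
  have hne : Nonempty (ConnectedSum e e') :=
    ⟨(smash_surjective e e' (by omega) (basePoint e e')).choose⟩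
  have hmono : ∀ {s t : ℝ}, s ≤ t → wedgeBall e e' s ⊆ wedgeBall e e' t := by
    intro s t hst w hw
    exact ⟨e.image_ball_subset hst hw.1, e'.image_ball_subset hst hw.2⟩
  -- Four increasing positive radii, ending with `ρ 3 = r`; each dimension moves to the next.
  let ρ : ℕ → ℝ := fun m => r * (m + 1) / 4
  have hρ : ∀ m, ρ m < ρ (m + 1) := by
    intro m
    simp only [ρ]
    push_cast
    linarith
  have hρ3 : ρ 3 = r := by
    simp only [ρ]
    push_cast
    ring
  obtain ⟨α', h1, h2⟩ := exists_extension_of_cellExtension hK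
    (R := fun m x w => smash e e' x = w ∨
      smash e e' x ∈ wedgeBall e e' (ρ m) ∧ w ∈ wedgeBall e e' (ρ m))
    (fun m w b => Or.imp_right fun h => ⟨hmono (hρ m).le h.1, hmono (hρ m).le h.2⟩)
    (fun m hm => by
      have h0 : 0 < ρ m := by simp only [ρ]; positivity
      have h2 : ρ m ≤ 2 := by
        have : (m : ℝ) ≤ 2 := by exact_mod_cast hm
        have : r * (m + 1) ≤ 2 * (2 + 1) := by gcongr
        simp only [ρ]
        linarith
      refine (cellExtension_smash e e' (by omega) h0 h2).mono fun w b => Or.imp_right fun h => ?_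
      exact ⟨wedgeClosedBall_subset_wedgeBall e e' (hρ m) h.1,
        wedgeClosedBall_subset_wedgeBall e e' (hρ m) h.2⟩)
    K₀ α₀ α fun u => Or.inl (h u)
  exact ⟨α', h1, by simpa only [hρ3] using h2⟩

/-- Maps of 2-complexes to `M` lift to the wedge of `M` and a simply connected space, up to an error
near the base point. -/
theorem exists_lift_fst [T2Space M] [SimplyConnectedSpace M'] (hK : IsTwoComplex K)
    (K₀ : RelCWComplex.Subcomplex (univ : Set K)) (α₀ : C(K₀, Wedge e.center e'.center))
    (α : C(K, M)) (h : ∀ u : K₀, (α₀ u).1.1 = α u) {r : ℝ} (hr : 0 < r) :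
    ∃ α' : C(K, Wedge e.center e'.center), (∀ u : K₀, α' u = α₀ u) ∧ ∀ u, (α' u).1.1 = α u ∨
      (α' u).1.1 ∈ e.emb '' ball 0 r ∧ α u ∈ e.emb '' ball 0 r := by
  have hne : Nonempty (Wedge e.center e'.center) := ⟨basePoint e e'⟩
  let ρ : ℕ → ℝ := fun m => r * (m + 1) / 4
  have hρ : ∀ m, ρ m < ρ (m + 1) := by
    intro m
    simp only [ρ]
    push_cast
    linarith
  have hρ3 : ρ 3 = r := by
    simp only [ρ]
    push_cast
    ring
  obtain ⟨α', h1, h2⟩ := exists_extension_of_cellExtension hK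
    (R := fun m (w : Wedge e.center e'.center) b => w.1.1 = b ∨
      w.1.1 ∈ e.emb '' ball 0 (ρ m) ∧ b ∈ e.emb '' ball 0 (ρ m))
    (fun m w b => Or.imp_right fun h =>
      ⟨e.image_ball_subset (hρ m).le h.1, e.image_ball_subset (hρ m).le h.2⟩)
    (fun m hm => cellExtension_fst e e' hm (by simp only [ρ]; positivity) (hρ m))
    K₀ α₀ α fun u => Or.inl (h u)
  exact ⟨α', h1, by simpa only [hρ3] using h2⟩

end ConnectedSum

open ConnectedSum

theorem isUV1Map_smash {n : ℕ} (hn : 3 ≤ n) {M : Type u} [TopologicalSpace M] [T2Space M]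
    [TopologicalSpace.MetrizableSpace M] {M' : Type v} [TopologicalSpace M'] [T2Space M']
    [TopologicalSpace.MetrizableSpace M'] (e : CoordBall n M) (e' : CoordBall n M') :
    IsUV1Map.{w} (ConnectedSum.smash e e') := by
  refine ⟨continuous_smash e e', IsEmbedding.subtypeVal.metrizableSpace, fun d hd δ hδ K _ _ _ hK K₀ α₀ α h => ?_⟩
  obtain ⟨U, hU, hUδ⟩ := exists_mem_nhds_forall_dist_lt d hd (basePoint e e') hδ
  obtain ⟨r, hr, hr2, hrU⟩ := exists_wedgeBall_subset e e' hU
  obtain ⟨α', h1, h2⟩ := exists_lift_smash e e' hn hK K₀ α₀ α h hr hr2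
  refine ⟨α', h1, fun u => ?_⟩
  rcases h2 u with h3 | h3
  · rw [h3]
    exact (d.dist_self _).trans_lt hδ
  · exact hUδ _ (hrU h3.1) _ (hrU h3.2)

theorem isUV1Map_collapse {n : ℕ} (hn : 3 ≤ n) {M : Type u} [TopologicalSpace M] [T2Space M]
    [TopologicalSpace.MetrizableSpace M] {M' : Type v} [TopologicalSpace M'] [T2Space M']
    [SimplyConnectedSpace M'] (e : CoordBall n M) (e' : CoordBall n M') :
    IsUV1Map.{w} (ConnectedSum.collapse e e') := by
  have hfst : Continuous fun w : Wedge e.center e'.center => w.1.1 := by fun_prop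
  have hp : collapse e e' = fun x => (smash e e' x).1.1 := funext (collapse_eq_fst_smash e e')
  refine ⟨hp ▸ hfst.comp (continuous_smash e e'), inferInstance,
    fun d hd δ hδ K _ _ _ hK K₀ α₀ α h => ?_⟩
  obtain ⟨U, hU, hUδ⟩ := exists_mem_nhds_forall_dist_lt d hd e.center (half_pos hδ)
  obtain ⟨r, hr, hr2, hrU⟩ := e.exists_image_ball_subset hU
  -- First lift to the wedge, prescribing the smash of `α₀` on `K₀`, then lift exactly that map to
  -- the connected sum; each stage costs `δ / 2`.
  obtain ⟨α₁, h1, h2⟩ := exists_lift_fst e e' hK K₀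
    ((⟨smash e e', continuous_smash e e'⟩ : C(_, _)).comp α₀) α
    (fun u => (collapse_eq_fst_smash e e' _).symm.trans (h u)) hr
  obtain ⟨α', h3, h4⟩ := exists_lift_smash e e' hn hK K₀ α₀ α₁ (fun u => (h1 u).symm) hr hr2
  refine ⟨α', h3, fun u => ?_⟩
  have hd1 : d.dist (collapse e e' (α' u)) (α₁ u).1.1 < δ / 2 := by
    rw [collapse_eq_fst_smash]
    rcases h4 u with h5 | h5
    · rw [h5]
      exact (d.dist_self _).trans_lt (half_pos hδ)
    · exact hUδ _ (hrU h5.1.1) _ (hrU h5.2.1)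
  have hd2 : d.dist (α₁ u).1.1 (α u) < δ / 2 := by
    rcases h2 u with h5 | h5
    · rw [h5]
      exact (d.dist_self _).trans_lt (half_pos hδ)
    · exact hUδ _ (hrU h5.1) _ (hrU h5.2)
  have := d.dist_triangle (collapse e e' (α' u)) (α₁ u).1.1 (α u)
  linarith

end
theorem lemma3p2 {n : ℕ} (hn : 3 ≤ n)
    {M : Type u} [TopologicalSpace M] [T2Space M] [SecondCountableTopology M]
    [ChartedSpace (EuclideanSpace ℝ (Fin n)) M]
    {M' : Type v} [TopologicalSpace M'] [T2Space M'] [SecondCountableTopology M']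
    [ChartedSpace (EuclideanSpace ℝ (Fin n)) M']
    (e : CoordBall n M) (e' : CoordBall n M') :
    (SimplyConnectedSpace M' → IsUV1Map.{w} (ConnectedSum.collapse e e')) ∧
      IsUV1Map.{w} (ConnectedSum.smash e e') := by
  have := metrizableSpace_of_chartedSpace n M
  have := metrizableSpace_of_chartedSpace n M'
  exact ⟨fun _ => isUV1Map_collapse hn e e', isUV1Map_smash hn e e'⟩
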